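/- Let $\mathbb T\subseteq\mathbb R$ be a time scale (a nonempty closed set), $a,b\in\mathbb T$, $a<b$, and let $S=[a,b]_{\mathbb T}=\{t\in\mathbb T: a\le t\le b\}$, regarded as a time scale. Write $\sigma(t)=\inf\{s\in S:s>t\}$ (with $\inf\emptyset=\max S$), $\rho(t)=\sup\{s\in S:s<t\}$ (with $\sup\emptyset=\min S$), $y^\sigma=y\circ\sigma$, $S^\kappa=\{t\in S: t\neq\max S\text{ or }\rho(t)=t\}$ and $S^{\kappa^2}=(S^\kappa)^\kappa$. Let $y^\Delta$ be the $\Delta$-derivative and $\int f\,\Delta t$ the $\Delta$-integral (difference of the values of an antiderivative), and let $C^1_{\rm rd}$ be the set of functions $y:S\to\mathbb R$ that are $\Delta$-differentiable on $S^\kappa$ with rd-continuous $y^\Delta$ (continuous at points with $\sigma(t)=t$, with finite left limits at points with $\rho(t)=t$), with norm $\|y\|=\sup_{S^\kappa}|y^\sigma|+\sup_{S^\kappa}|y^\Delta|$. Write $[y](t)=(t,y^\sigma(t),y^\Delta(t))$. Let $L,g:S^\kappa\times\mathbb R^2\to\mathbb R$, $(t,u,v)\mapsto L(t,u,v),\,g(t,u,v)$,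 be such that each $f\in\{L,g\}$ satisfies: $f(t,\cdot,\cdot)$ is $C^2$ for every $t$; $f[y]$, $f_u[y]$, $f_v[y]$ are rd-continuous for every $y\in C^1_{\rm rd}$; and for all $y,\eta\in C^1_{\rm rd}$ the first and second derivatives with respect to $\varepsilon$ of $f(t,y^\sigma(t)+\varepsilon\eta^\sigma(t),y^\Delta(t)+\varepsilon\eta^\Delta(t))$ are continuous in $\varepsilon$, uniformly in $t\in S^\kappa$. Let $y_a,y_b,l\in\mathbb R$ and call $y\in C^1_{\rm rd}$ admissible if $y(a)=y_a$, $y(b)=y_b$ and $\int_a^b g[y](t)\,\Delta t=l$. Let $y_*$ be a local minimiser of $J(y)=\int_a^b L[y](t)\,\Delta t$ among admissible functions, that is, $y_*$ is admissible and for some $\delta>0$, $J(y_*)\le J(y)$ for all admissible $y$ with $\|y-y_*\|<\delta$. Suppose that $y_*$ is not an extremal of the constraint functional, that is, $t\mapsto g_v[y_*](t)-\int_a^t g_u[y_*](\tau)\,\Delta\tau$ is not constant on $S^\kappa$. Then there is $\lambda\in\mathbb R$ such that, with $F=L-\lambda g$, the function $F_v[y_*]$ on the time scale $S^\kappa$ is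 $\Delta$-differentiable at every point of $S^{\kappa^2}$ and $$(F_v[y_*])^\Delta(t)-F_u[y_*](t)=0\qquad\text{for all }t\in S^{\kappa^2},$$ except that at the point $t=\rho(b)$, in case $\rho(b)<b$ and $\rho(b)$ is left-dense (i.e. $\rho(\rho(b))=\rho(b)$), $F_u[y_*](t)$ is to be replaced by its left-hand limit $\lim_{s\uparrow t}F_u[y_*](s)$ (when there are points of $S$ to the left of $t$). -/

import Mathlib

open Set Filter Topology

namespace TimeScale

noncomputable section

open Classical in
/-- Forward jump operator of the time scale `S`: `σ(t) = inf {s ∈ S : s > t}`, with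
`inf ∅ = sup S`. -/
def sigma (S : Set ℝ) (t : ℝ) : ℝ :=
  if {s | s ∈ S ∧ t < s}.Nonempty then sInf {s | s ∈ S ∧ t < s} else sSup S

open Classical in
/-- Backward jump operator of the time scale `S`: `ρ(t) = sup {s ∈ S : s < t}`, with
`sup ∅ = inf S`. -/
def rho (S : Set ℝ) (t : ℝ) : ℝ :=
  if {s | s ∈ S ∧ s < t}.Nonempty then sSup {s | s ∈ S ∧ s < t} else sInf S

/-- `S^κ`: the points of `S` that are not maximal or are left-dense. -/
def kappa (S : Set ℝ) : Set ℝ :=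
  {t | t ∈ S ∧ ((∃ s ∈ S, t < s) ∨ rho S t = t)}

/-- The time scale interval `[a,b]_T`. -/
def interval (T : Set ℝ) (a b : ℝ) : Set ℝ :=
  {t | t ∈ T ∧ a ≤ t ∧ t ≤ b}

/-- `f` has `Δ`-derivative `m` at `t`, with respect to the time scale `S`. Only the values of `f`
on `S` matter. -/
def HasDeltaDerivAt (S : Set ℝ) (f : ℝ → ℝ) (m t : ℝ) : Prop :=
  ∀ ε : ℝ, 0 < ε → ∃ δ : ℝ, 0 < δ ∧ ∀ s ∈ S, |s - t| < δ →
    |f (sigma S t) - f s - m * (sigma S t - s)| ≤ ε * |sigma S t - s|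

/-- `f` is `Δ`-differentiable at `t`. -/
def DeltaDifferentiableAt (S : Set ℝ) (f : ℝ → ℝ) (t : ℝ) : Prop :=
  ∃ m : ℝ, HasDeltaDerivAt S f m t

open Classical in
/-- The `Δ`-derivative `f^Δ(t)` (and `0` where `f` is not `Δ`-differentiable). -/
def deltaDeriv (S : Set ℝ) (f : ℝ → ℝ) (t : ℝ) : ℝ :=
  if h : DeltaDifferentiableAt S f t then h.choose else 0

/-- Rd-continuity on `A ⊆ S` (here `A = S` or `A = S^κ`): `f` is continuous at the right-dense
points and has finite left-sided limits at the left-dense points; "dense" refers to `S`. -/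
def RdContinuousOn (S A : Set ℝ) (f : ℝ → ℝ) : Prop :=
  ∀ t ∈ A, (sigma S t = t → ContinuousWithinAt f A t) ∧
    (rho S t = t → ∃ m : ℝ, Tendsto f (𝓝[A ∩ Iio t] t) (𝓝 m))

/-- The class `C¹_rd(S)`: `Δ`-differentiable on `S^κ` with rd-continuous `Δ`-derivative. -/
def IsC1rd (S : Set ℝ) (y : ℝ → ℝ) : Prop :=
  (∀ t ∈ kappa S, DeltaDifferentiableAt S y t) ∧ RdContinuousOn S (kappa S) (deltaDeriv S y)

/-- `F` is an antiderivative of `f` on the time scale `S`. -/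
def IsAntiderivative (S : Set ℝ) (F f : ℝ → ℝ) : Prop :=
  ∀ t ∈ kappa S, HasDeltaDerivAt S F (f t) t

open Classical in
/-- The `Δ`-integral `∫_s^r f(t) Δt = F(r) - F(s)`, where `F` is an antiderivative of `f`
(and `0` if there is none; every rd-continuous function has one). -/
def deltaIntegral (S : Set ℝ) (f : ℝ → ℝ) (s r : ℝ) : ℝ :=
  if h : ∃ F : ℝ → ℝ, IsAntiderivative S F f then h.choose r - h.choose s else 0

/-- The partial derivative `L_u` of `L(t,u,v)`. -/
def partialU (L : ℝ → ℝ → ℝ → ℝ) (t u v : ℝ) : ℝ := deriv (fun x => L t x v) u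

/-- The partial derivative `L_v` of `L(t,u,v)`. -/
def partialV (L : ℝ → ℝ → ℝ → ℝ) (t u v : ℝ) : ℝ := deriv (fun x => L t u x) v

/-- `t ↦ L(t, y^σ(t), y^Δ(t))`. -/
def along (S : Set ℝ) (L : ℝ → ℝ → ℝ → ℝ) (y : ℝ → ℝ) (t : ℝ) : ℝ :=
  L t (y (sigma S t)) (deltaDeriv S y t)

/-- `f(t, ε) = L(t, y^σ(t) + ε η^σ(t), y^Δ(t) + ε η^Δ(t))`. -/
def alongLine (S : Set ℝ) (L : ℝ → ℝ → ℝ → ℝ) (y η : ℝ → ℝ) (t ε : ℝ) : ℝ :=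
  L t (y (sigma S t) + ε * η (sigma S t)) (deltaDeriv S y t + ε * deltaDeriv S η t)

/-- `f(t,x)` is continuous in `x`, uniformly in `t ∈ A`. The radius may depend on the point `x`;
this is implied by the variant in which it may not. -/
def ContinuousUniformlyOn (A : Set ℝ) (f : ℝ → ℝ → ℝ) : Prop :=
  ∀ x : ℝ, ∀ e : ℝ, 0 < e → ∃ δ : ℝ, 0 < δ ∧
    ∀ x' : ℝ, |x' - x| < δ → ∀ t ∈ A, |f t x' - f t x| < e

/-- The standing assumptions on an integrand `L(t,u,v)`, `t ∈ S^κ`: it is `C²` in `(u,v)` for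
every `t`; the integrands of the functional and of its first variation are rd-continuous along
every `y ∈ C¹_rd`; and for all `y, η ∈ C¹_rd` the derivatives `f_ε` and `f_εε` of
`f(t, ε) = L(t, y^σ(t) + ε η^σ(t), y^Δ(t) + ε η^Δ(t))` are continuous in `ε`,
uniformly in `t`. -/
structure IsRegularIntegrand (S : Set ℝ) (L : ℝ → ℝ → ℝ → ℝ) : Prop where
  contDiff : ∀ t ∈ kappa S, ContDiff ℝ 2 (fun p : ℝ × ℝ => L t p.1 p.2)
  rd : ∀ y, IsC1rd S y → RdContinuousOn S (kappa S) (along S L y)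
  rd_u : ∀ y, IsC1rd S y → RdContinuousOn S (kappa S) (along S (partialU L) y)
  rd_v : ∀ y, IsC1rd S y → RdContinuousOn S (kappa S) (along S (partialV L) y)
  unif_first : ∀ y η, IsC1rd S y → IsC1rd S η →
    ContinuousUniformlyOn (kappa S) (fun t => deriv (alongLine S L y η t))
  unif_second : ∀ y η, IsC1rd S y → IsC1rd S η →
    ContinuousUniformlyOn (kappa S) (fun t => deriv (deriv (alongLine S L y η t)))

/-- The functional `y ↦ ∫_a^b L(t, y^σ(t), y^Δ(t)) Δt`. -/
def functional (S : Set ℝ) (a b : ℝ) (L : ℝ → ℝ → ℝ → ℝ) (y : ℝ → ℝ) : ℝ :=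
  deltaIntegral S (along S L y) a b

/-- The norm `‖f‖ = sup |f^σ| + sup |f^Δ|`, both suprema over `S^κ`. -/
def c1norm (S : Set ℝ) (f : ℝ → ℝ) : ℝ :=
  sSup ((fun t => |f (sigma S t)|) '' kappa S) + sSup ((fun t => |deltaDeriv S f t|) '' kappa S)

/-- Admissible functions of the isoperimetric problem: `y ∈ C¹_rd`, `y(a) = ya`, `y(b) = yb` and
`∫_a^b g(t, y^σ(t), y^Δ(t)) Δt = l`. -/
def IsAdmissible (S : Set ℝ) (a b : ℝ) (g : ℝ → ℝ → ℝ → ℝ) (ya yb l : ℝ) (y : ℝ → ℝ) : Prop :=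
  IsC1rd S y ∧ y a = ya ∧ y b = yb ∧ functional S a b g y = l

/-- `ystar` is a (weak) local minimiser of the functional with integrand `L` among the admissible
functions of the isoperimetric problem. -/
def IsLocalMinimiser (S : Set ℝ) (a b : ℝ) (L g : ℝ → ℝ → ℝ → ℝ) (ya yb l : ℝ)
    (ystar : ℝ → ℝ) : Prop :=
  IsAdmissible S a b g ya yb l ystar ∧
    ∃ δ : ℝ, 0 < δ ∧ ∀ y : ℝ → ℝ, IsAdmissible S a b g ya yb l y →
      c1norm S (fun t => y t - ystar t) < δ →
        functional S a b L ystar ≤ functional S a b L y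

/-- `y` is an extremal of the functional with integrand `g`:
`g_v(t, y^σ(t), y^Δ(t)) - ∫_a^t g_u(τ, y^σ(τ), y^Δ(τ)) Δτ` is constant on `S^κ`. -/
def IsExtremal (S : Set ℝ) (a : ℝ) (g : ℝ → ℝ → ℝ → ℝ) (y : ℝ → ℝ) : Prop :=
  ∃ c : ℝ, ∀ t ∈ kappa S,
    along S (partialV g) y t - deltaIntegral S (along S (partialU g) y) a t = c

/-- The Euler–Lagrange equation `F_v^Δ - F_u = 0` along `y` on `S^{κ²}`, where
`t ↦ F_v(t, y^σ(t), y^Δ(t))` is `Δ`-differentiated as a function on the time scale `S^κ`, on which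
it lives. The second clause concerns only the point `t` before a left-scattered maximum
`σ(t) ∉ S^κ` of `S`, which belongs to `S^{κ²}` if it is left-dense: on `S^κ` only the left-hand
derivative is seen there, and it is compared with the left-hand limit of `F_u`. -/
def SatisfiesEulerLagrange (S : Set ℝ) (F : ℝ → ℝ → ℝ → ℝ) (y : ℝ → ℝ) : Prop :=
  (∀ t ∈ kappa (kappa S), sigma S t ∈ kappa S →
    HasDeltaDerivAt (kappa S) (along S (partialV F) y) (along S (partialU F) y t) t) ∧
  (∀ t ∈ kappa (kappa S), sigma S t ∉ kappa S →
    ∃ m : ℝ, Tendsto (along S (partialU F) y) (𝓝[kappa S ∩ Iio t] t) (𝓝 m) ∧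
      HasDeltaDerivAt (kappa S) (along S (partialV F) y) m t)

end

end TimeScale

/-!
The proof has four parts.

*Integration.* For a compact time scale `S` with ends `a < b`, composing an rd-continuous `f` with
`lastPoint S` gives a bounded function on `[a,b)` that is right-continuous, hence integrable. Its
Lebesgue integral over `[a,t]` is a `Δ`-antiderivative of `f`, and a function with zero
`Δ`-derivative is constant, so the `Δ`-integral is this Lebesgue integral (`deltaIntegral_eq`).

*Differentiability of the functionals.* The regularity hypotheses are about single lines
`ε ↦ y + ε η`, whereas the multiplier rule needs strict differentiability in two parameters. The gap
is closed by `IsRegularIntegrand.partials_equicontinuous`: `L_u` and `L_v` are continuous at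
`[y](t)`, uniformly in `t`. If this failed along points `t_n → t₀` and perturbations
`(α_n, β_n) → 0`, one could choose `z = y + η q` in `C¹_rd`, with `q^Δ` prescribed at the `t_n` by
Tietze's theorem, whose line in the direction `η` meets all the perturbed points at parameters
tending to `0`. Uniformity along this line makes the directional derivatives converge along the
perturbed points; leaving every other point unperturbed shows that the limit is the unperturbed one.

*Multipliers.* As `y_*` is not an extremal of the constraint, the lemma of du Bois-Reymond
(`exists_const_of_integral_eq_zero`) gives a direction `η` in which the first variation of the
constraint does not vanish. For each further direction `ζ`, the Lagrange multiplier theorem in `ℝ²`,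
applied to `p ↦ y_* + p₁ η + p₂ ζ`, shows that the first variation of `F = L - λ g` vanishes at `ζ`,
with `λ` the ratio of the two first variations at `η`.

*The equation.* By du Bois-Reymond again, `F_v[y_*] - ∫_a^t F_u[y_*] Δτ` is constant on `S^κ`, and
differentiating this on the time scale `S^κ` gives the Euler–Lagrange equation
(`hasDeltaDerivAt_kappa_of_sub_integral_eq`).
-/

namespace TimeScale

section
variable {S : Set ℝ} {a b : ℝ}

/-! ### Calculus of the delta derivative -/

/-- `S` is a compact time scale with minimum `a` and maximum `b`, and not a single point. -/
structure IsCompactScale (S : Set ℝ) (a b : ℝ) : Prop where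
  closed : IsClosed S
  least : IsLeast S a
  greatest : IsGreatest S b
  lt : a < b

lemma isCompactScale_interval {T : Set ℝ} (hT : IsClosed T) {a b : ℝ} (ha : a ∈ T) (hb : b ∈ T)
    (hab : a < b) : IsCompactScale (interval T a b) a b where
  closed := by
    have : interval T a b = T ∩ Icc a b := by
      ext; simp only [interval, mem_inter_iff, mem_ofPred_eq, mem_Icc]
    rw [this]
    exact hT.inter isClosed_Icc
  least := ⟨⟨ha, le_rfl, hab.le⟩, fun _ h => h.2.1⟩
  greatest := ⟨⟨hb, hab.le, le_rfl⟩, fun _ h => h.2.2⟩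
  lt := hab

lemma hasDeltaDerivAt_iff_isLittleO {S : Set ℝ} {f : ℝ → ℝ} {m t : ℝ} :
    HasDeltaDerivAt S f m t ↔
      (fun s => f (sigma S t) - f s - m * (sigma S t - s)) =o[𝓝[S] t] fun s => sigma S t - s := by
  simp only [HasDeltaDerivAt, Asymptotics.isLittleO_iff, Real.norm_eq_abs]
  refine forall₂_congr fun ε _ => ?_
  rw [(nhdsWithin_hasBasis Metric.nhds_basis_ball S).eventually_iff]
  refine exists_congr fun δ => and_congr_right fun _ => ?_
  simp only [mem_inter_iff, Metric.mem_ball, Real.dist_eq]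
  exact ⟨fun h s hs => h s hs.2 hs.1, fun h s hs hd => h ⟨hd, hs⟩⟩

lemma HasDeltaDerivAt.add {S : Set ℝ} {f g : ℝ → ℝ} {m n t : ℝ} (hf : HasDeltaDerivAt S f m t)
    (hg : HasDeltaDerivAt S g n t) : HasDeltaDerivAt S (fun s => f s + g s) (m + n) t := by
  rw [hasDeltaDerivAt_iff_isLittleO] at *
  refine (hf.add hg).congr_left fun s => by ring

lemma HasDeltaDerivAt.const_mul {S : Set ℝ} {f : ℝ → ℝ} {m t : ℝ} (c : ℝ)
    (hf : HasDeltaDerivAt S f m t) : HasDeltaDerivAt S (fun s => c * f s) (c * m) t := by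
  rw [hasDeltaDerivAt_iff_isLittleO] at *
  refine (hf.const_mul_left c).congr_left fun s => by ring

lemma HasDeltaDerivAt.sub {S : Set ℝ} {f g : ℝ → ℝ} {m n t : ℝ} (hf : HasDeltaDerivAt S f m t)
    (hg : HasDeltaDerivAt S g n t) : HasDeltaDerivAt S (fun s => f s - g s) (m - n) t := by
  rw [hasDeltaDerivAt_iff_isLittleO] at *
  refine (hf.sub hg).congr_left fun s => by ring

lemma hasDeltaDerivAt_const (S : Set ℝ) (c t : ℝ) : HasDeltaDerivAt S (fun _ => c) 0 t :=
  fun ε hε => ⟨1, one_pos, fun s _ _ => by simpa using by positivity⟩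

lemma hasDeltaDerivAt_id (S : Set ℝ) (t : ℝ) : HasDeltaDerivAt S (fun s => s) 1 t :=
  fun ε hε => ⟨1, one_pos, fun s _ _ => by simpa using by positivity⟩

lemma HasDeltaDerivAt.tendsto {S : Set ℝ} {f : ℝ → ℝ} {m t : ℝ} (ht : t ∈ S)
    (hf : HasDeltaDerivAt S f m t) : Tendsto f (𝓝[S] t) (𝓝 (f t)) := by
  have hσ : Tendsto (fun s => sigma S t - s) (𝓝[S] t) (𝓝 (sigma S t - t)) :=
    (tendsto_const_nhds.sub tendsto_id).mono_left nhdsWithin_le_nhds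
  -- evaluating the defining estimate at `s = t` itself gives `f^σ - f = m (σ(t) - t)`
  have h0 : f (sigma S t) - f t - m * (sigma S t - t) = 0 := by
    have key : ∀ ε : ℝ, 0 < ε →
        |f (sigma S t) - f t - m * (sigma S t - t)| ≤ ε * |sigma S t - t| := fun ε hε => by
      obtain ⟨δ, hδ, h⟩ := hf ε hε
      exact h t ht (by simpa using hδ)
    have hl : Tendsto (fun ε : ℝ => ε * |sigma S t - t|) (𝓝[>] 0) (𝓝 (0 * |sigma S t - t|)) :=
      (tendsto_id.mul_const _).mono_left nhdsWithin_le_nhds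
    have := ge_of_tendsto hl (eventually_mem_nhdsWithin.mono fun ε hε => key ε hε)
    rw [zero_mul] at this
    exact abs_nonpos_iff.1 this
  have h1 : Tendsto (fun s => f (sigma S t) - f s - m * (sigma S t - s)) (𝓝[S] t) (𝓝 0) := by
    rw [Metric.tendsto_nhds]
    intro e he
    set K := |sigma S t - t| + 1
    have hKpos : 0 < K := by positivity
    obtain ⟨δ, hδ, h⟩ := hf (e / (2 * K)) (by positivity)
    filter_upwards [inter_mem_nhdsWithin S (Metric.ball_mem_nhds t (lt_min hδ one_pos))] with s hs
    have hd : |s - t| < min δ 1 := by simpa [Real.dist_eq] using hs.2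
    have h2 := h s hs.1 (hd.trans_le (min_le_left _ _))
    have h3 : |sigma S t - s| ≤ K := by
      have := abs_sub_le (sigma S t) t s
      rw [abs_sub_comm t s] at this
      have := hd.trans_le (min_le_right _ _)
      linarith
    rw [Real.dist_eq, sub_zero]
    calc _ ≤ e / (2 * K) * |sigma S t - s| := h2
      _ ≤ e / (2 * K) * K := by gcongr
      _ = e / 2 := by field_simp
      _ < e := by linarith
  have h2 := (tendsto_const_nhds (x := f (sigma S t))).sub (h1.add (hσ.const_mul m))
  have e1 : f (sigma S t) - (0 + m * (sigma S t - t)) = f t := by linarith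
  rw [e1] at h2
  exact h2.congr fun s => by ring

/-- The product rule `(f g)^Δ = f^Δ g^σ + f g^Δ`. -/
lemma HasDeltaDerivAt.mul {S : Set ℝ} {f g : ℝ → ℝ} {m n t : ℝ} (ht : t ∈ S)
    (hf : HasDeltaDerivAt S f m t) (hg : HasDeltaDerivAt S g n t) :
    HasDeltaDerivAt S (fun s => f s * g s) (m * g (sigma S t) + f t * n) t := by
  have hc := hf.tendsto ht
  rw [hasDeltaDerivAt_iff_isLittleO] at *
  have h1 := hf.const_mul_left (g (sigma S t))
  have h2 := (hc.isBigO_one ℝ).mul_isLittleO hg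
  have h3 : (fun s => (f s - f t) * n * (sigma S t - s)) =o[𝓝[S] t]
      fun s => (1 : ℝ) * (sigma S t - s) := by
    refine Asymptotics.IsLittleO.mul_isBigO ?_ (Asymptotics.isBigO_refl _ _)
    rw [Asymptotics.isLittleO_one_iff]
    have := (hc.sub_const (f t)).mul_const n
    simpa using this
  simp only [one_mul] at h2 h3
  refine ((h1.add h2).add h3).congr_left fun s => by ring

/-! ### Jump operators -/


namespace IsCompactScale

lemma bddBelow (hS : IsCompactScale S a b) (A : Set ℝ) (hA : A ⊆ S) : BddBelow A :=
  ⟨a, fun _ h => hS.least.2 (hA h)⟩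

lemma bddAbove (hS : IsCompactScale S a b) (A : Set ℝ) (hA : A ⊆ S) : BddAbove A :=
  ⟨b, fun _ h => hS.greatest.2 (hA h)⟩

lemma isCompact (hS : IsCompactScale S a b) : IsCompact S :=
  isCompact_Icc.of_isClosed_subset hS.closed fun _ h => ⟨hS.least.2 h, hS.greatest.2 h⟩

lemma sigma_le (hS : IsCompactScale S a b) {s t : ℝ} (hs : s ∈ S) (hst : t < s) :
    sigma S t ≤ s := by
  rw [sigma, if_pos ⟨s, hs, hst⟩]
  exact csInf_le (hS.bddBelow _ fun _ h => h.1) ⟨hs, hst⟩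

lemma le_sigma (hS : IsCompactScale S a b) {t : ℝ} (ht : t ∈ S) : t ≤ sigma S t := by
  by_cases h : {s | s ∈ S ∧ t < s}.Nonempty
  · rw [sigma, if_pos h]
    exact le_csInf h fun s hs => hs.2.le
  · rw [sigma, if_neg h, hS.greatest.csSup_eq]
    exact hS.greatest.2 ht

lemma sigma_mem (hS : IsCompactScale S a b) (t : ℝ) : sigma S t ∈ S := by
  by_cases h : {s | s ∈ S ∧ t < s}.Nonempty
  · rw [sigma, if_pos h]
    have := csInf_mem_closure h (hS.bddBelow _ fun _ h => h.1)
    exact hS.closed.closure_subset_iff.2 (fun _ h => h.1) this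
  · rw [sigma, if_neg h, hS.greatest.csSup_eq]
    exact hS.greatest.1

lemma exists_mem_Ioo_of_sigma_eq (hS : IsCompactScale S a b) {t c : ℝ} (htb : t < b)
    (hσ : sigma S t = t) (hc : t < c) : ∃ s ∈ S, t < s ∧ s < c := by
  have hne : {s | s ∈ S ∧ t < s}.Nonempty := ⟨b, hS.greatest.1, htb⟩
  rw [sigma, if_pos hne] at hσ
  obtain ⟨s, hs, h⟩ := exists_lt_of_csInf_lt hne (hσ.trans_lt hc)
  exact ⟨s, hs.1, hs.2, h⟩

lemma exists_mem_Ioo_of_rho_eq (hS : IsCompactScale S a b) {t c : ℝ} (hta : a < t)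
    (hρ : rho S t = t) (hc : c < t) : ∃ s ∈ S, c < s ∧ s < t := by
  have hne : {s | s ∈ S ∧ s < t}.Nonempty := ⟨a, hS.least.1, hta⟩
  rw [rho, if_pos hne] at hρ
  obtain ⟨s, hs, h⟩ := exists_lt_of_lt_csSup hne (hc.trans_eq hρ.symm)
  exact ⟨s, hs.1, h, hs.2⟩

lemma le_rho (hS : IsCompactScale S a b) {s t : ℝ} (hs : s ∈ S) (hst : s < t) :
    s ≤ rho S t := by
  rw [rho, if_pos ⟨s, hs, hst⟩]
  exact le_csSup (hS.bddAbove _ fun _ h => h.1) ⟨hs, hst⟩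

lemma rho_le (hS : IsCompactScale S a b) {t : ℝ} (ht : t ∈ S) : rho S t ≤ t := by
  by_cases h : {s | s ∈ S ∧ s < t}.Nonempty
  · rw [rho, if_pos h]
    exact csSup_le h fun s hs => hs.2.le
  · rw [rho, if_neg h, hS.least.csInf_eq]
    exact hS.least.2 ht

lemma rho_mem (hS : IsCompactScale S a b) (t : ℝ) : rho S t ∈ S := by
  by_cases h : {s | s ∈ S ∧ s < t}.Nonempty
  · rw [rho, if_pos h]
    have := csSup_mem_closure h (hS.bddAbove _ fun _ h => h.1)
    exact hS.closed.closure_subset_iff.2 (fun _ h => h.1) this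
  · rw [rho, if_neg h, hS.least.csInf_eq]
    exact hS.least.1

lemma sigma_rho (hS : IsCompactScale S a b) {t : ℝ} (ht : t ∈ S) (h : rho S t < t) :
    sigma S (rho S t) = t := by
  refine le_antisymm (hS.sigma_le ht h) ?_
  rw [sigma, if_pos ⟨t, ht, h⟩]
  refine le_csInf ⟨t, ht, h⟩ fun s hs => ?_
  by_contra! hlt
  exact absurd (hS.le_rho hs.1 hlt) (not_le.2 hs.2)

lemma mem_kappa_of_lt (hS : IsCompactScale S a b) {t : ℝ} (ht : t ∈ S) (h : t < b) :
    t ∈ kappa S := ⟨ht, Or.inl ⟨b, hS.greatest.1, h⟩⟩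

lemma min_mem_kappa (hS : IsCompactScale S a b) : a ∈ kappa S :=
  hS.mem_kappa_of_lt hS.least.1 hS.lt

lemma nhdsLT_eq_bot (hS : IsCompactScale S a b) {t : ℝ} (h : rho S t < t) :
    𝓝[S ∩ Iio t] t = ⊥ := by
  rw [← empty_mem_iff_bot]
  have : S ∩ Iio t ∩ Ioi (rho S t) ∈ 𝓝[S ∩ Iio t] t :=
    inter_mem_nhdsWithin _ (isOpen_Ioi.mem_nhds h)
  refine mem_of_superset this ?_
  rintro s ⟨⟨hs, hst⟩, hr⟩
  exact absurd (hS.le_rho hs hst) (not_le.2 hr)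

lemma nhdsGT_eq_bot (hS : IsCompactScale S a b) {t : ℝ} (h : t < sigma S t) :
    𝓝[S ∩ Ioi t] t = ⊥ := by
  rw [← empty_mem_iff_bot]
  have : S ∩ Ioi t ∩ Iio (sigma S t) ∈ 𝓝[S ∩ Ioi t] t :=
    inter_mem_nhdsWithin _ (isOpen_Iio.mem_nhds h)
  refine mem_of_superset this ?_
  rintro s ⟨⟨hs, hst⟩, hr⟩
  exact absurd (hS.sigma_le hs hst) (not_le.2 hr)

/-- `σ` maps punctured neighbourhoods of a point into its neighbourhoods, even where `σ` is
discontinuous. -/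
lemma tendsto_sigma (hS : IsCompactScale S a b) {t : ℝ} (ht : t ∈ S) :
    Tendsto (sigma S) (𝓝[S \ {t}] t) (𝓝[S] t) := by
  have hsplit : S \ {t} = S ∩ Iio t ∪ S ∩ Ioi t := by
    ext s; simp only [Set.mem_sdiff, mem_singleton_iff, mem_union, mem_inter_iff, mem_Iio, mem_Ioi]
    rw [← ne_eq, ne_iff_lt_or_gt, and_or_left]
  rw [hsplit, nhdsWithin_union]
  refine tendsto_nhdsWithin_of_tendsto_nhds_of_eventually_within _ ?_
    (Eventually.of_forall hS.sigma_mem)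
  refine Tendsto.sup ?_ ?_
  · refine tendsto_of_tendsto_of_tendsto_of_le_of_le' (g := fun s => s) (h := fun _ => t)
      (tendsto_id.mono_left nhdsWithin_le_nhds) tendsto_const_nhds ?_ ?_
    · filter_upwards [self_mem_nhdsWithin] with s hs using hS.le_sigma hs.1
    · filter_upwards [self_mem_nhdsWithin] with s hs using hS.sigma_le ht hs.2
  · rcases (hS.le_sigma ht).lt_or_eq with h | h
    · rw [hS.nhdsGT_eq_bot h]; exact tendsto_bot
    rw [tendsto_order]
    constructor
    · intro c hc
      filter_upwards [self_mem_nhdsWithin] with s hs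
      exact hc.trans (lt_of_lt_of_le hs.2 (hS.le_sigma hs.1))
    · intro c hc
      rcases (hS.greatest.2 ht).lt_or_eq with htb | htb
      · obtain ⟨r, hr, htr, hrc⟩ := hS.exists_mem_Ioo_of_sigma_eq htb h.symm hc
        filter_upwards [nhdsWithin_le_nhds (isOpen_Iio.mem_nhds htr)] with s hs
        exact (hS.sigma_le hr hs).trans_lt hrc
      · filter_upwards [self_mem_nhdsWithin] with s hs
        exact absurd (hS.greatest.2 hs.1) (not_le.2 (htb ▸ hs.2))

end IsCompactScale

/-! ### Uniqueness of derivatives and antiderivatives -/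

/-- At the points of `S^κ` the `Δ`-derivative is unique. -/
lemma HasDeltaDerivAt.unique (hS : IsCompactScale S a b) {f : ℝ → ℝ} {m n t : ℝ}
    (ht : t ∈ kappa S) (hm : HasDeltaDerivAt S f m t) (hn : HasDeltaDerivAt S f n t) : m = n := by
  have h := hm.sub hn
  simp only [sub_self] at h
  by_contra hne
  have hpos : 0 < |m - n| := abs_pos.2 (sub_ne_zero.2 hne)
  obtain ⟨δ, hδ, H⟩ := h (|m - n| / 2) (by positivity)
  suffices ∃ s ∈ S, |s - t| < δ ∧ sigma S t ≠ s by
    obtain ⟨s, hs, hd, hne'⟩ := this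
    have h1 := H s hs hd
    have h2 : 0 < |sigma S t - s| := abs_pos.2 (sub_ne_zero.2 hne')
    simp only [sub_self, zero_sub, abs_neg, abs_mul] at h1
    nlinarith
  rcases (hS.le_sigma ht.1).lt_or_eq with hσ | hσ
  · exact ⟨t, ht.1, by simpa using hδ, hσ.ne'⟩
  rcases (hS.greatest.2 ht.1).lt_or_eq with htb | htb
  · obtain ⟨s, hs, h1, h2⟩ := hS.exists_mem_Ioo_of_sigma_eq htb hσ.symm (lt_add_of_pos_right t hδ)
    exact ⟨s, hs, by rw [abs_of_pos] <;> linarith, by rw [← hσ]; exact h1.ne⟩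
  · have hρ : rho S t = t := by
      rcases ht.2 with ⟨s, hs, hts⟩ | h
      · exact absurd (hS.greatest.2 hs) (not_le.2 (htb ▸ hts))
      · exact h
    obtain ⟨s, hs, h1, h2⟩ := hS.exists_mem_Ioo_of_rho_eq (htb ▸ hS.lt) hρ
      (sub_lt_self t hδ)
    exact ⟨s, hs, by rw [abs_of_neg] <;> linarith, by rw [← hσ]; exact h2.ne'⟩

lemma DeltaDifferentiableAt.hasDeltaDerivAt {f : ℝ → ℝ} {t : ℝ}
    (h : DeltaDifferentiableAt S f t) : HasDeltaDerivAt S f (deltaDeriv S f t) t := by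
  rw [deltaDeriv, dif_pos h]
  exact h.choose_spec

lemma HasDeltaDerivAt.deltaDeriv_eq (hS : IsCompactScale S a b) {f : ℝ → ℝ} {m t : ℝ}
    (ht : t ∈ kappa S) (h : HasDeltaDerivAt S f m t) : deltaDeriv S f t = m :=
  (DeltaDifferentiableAt.hasDeltaDerivAt ⟨m, h⟩).unique hS ht h

/-- A function with zero `Δ`-derivative is constant. The proof looks at the infimum of the points
where `|F t - F a| ≤ ε (t - a)` fails. -/
lemma eq_of_hasDeltaDerivAt_zero (hS : IsCompactScale S a b) {F : ℝ → ℝ}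
    (hF : ∀ t ∈ kappa S, HasDeltaDerivAt S F 0 t) {t : ℝ} (ht : t ∈ S) : F t = F a := by
  have hjump : ∀ t ∈ kappa S, F (sigma S t) = F t := by
    intro t ht
    by_cases hσ : sigma S t = t
    · rw [hσ]
    have h : Tendsto (fun ε : ℝ => ε * |sigma S t - t|) (𝓝[>] 0) (𝓝 (0 * |sigma S t - t|)) :=
      (tendsto_id.mul_const _).mono_left nhdsWithin_le_nhds
    have h2 : ∀ᶠ ε : ℝ in 𝓝[>] 0, |F (sigma S t) - F t| ≤ ε * |sigma S t - t| := by
      filter_upwards [self_mem_nhdsWithin] with ε hε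
      obtain ⟨δ, hδ, H⟩ := hF t ht ε hε
      simpa using H t ht.1 (by simpa using hδ)
    have := ge_of_tendsto h h2
    rw [zero_mul] at this
    exact sub_eq_zero.1 (abs_nonpos_iff.1 this)
  have main : ∀ ε : ℝ, 0 < ε → ∀ t ∈ S, |F t - F a| ≤ ε * (t - a) := by
    intro ε hε
    by_contra! hcon
    set B := {t | t ∈ S ∧ ε * (t - a) < |F t - F a|}
    have hBne : B.Nonempty := hcon
    have hBbdd : BddBelow B := hS.bddBelow _ fun _ h => h.1
    set c := sInf B
    have hcS : c ∈ S := hS.closed.closure_subset_iff.2 (fun _ h => h.1)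
      (csInf_mem_closure hBne hBbdd)
    have hbelow : ∀ s ∈ S, s < c → |F s - F a| ≤ ε * (s - a) := fun s hs hsc => by
      by_contra! h
      exact absurd (csInf_le hBbdd (show s ∈ B from ⟨hs, h⟩)) (not_le.2 hsc)
    by_cases hcB : c ∈ B
    · have hac : a < c := by
        refine lt_of_le_of_ne (hS.least.2 hcS) fun h => ?_
        have := hcB.2
        rw [← h] at this
        simp at this
      rcases (hS.rho_le hcS).lt_or_eq with hρ | hρ
      · have h1 := hjump _ (hS.mem_kappa_of_lt (hS.rho_mem c) (hρ.trans_le (hS.greatest.2 hcS)))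
        rw [hS.sigma_rho hcS hρ] at h1
        have h2 := hbelow _ (hS.rho_mem c) hρ
        rw [← h1] at h2
        have h3 := hcB.2
        nlinarith
      · have hck : c ∈ kappa S := ⟨hcS, Or.inr hρ⟩
        have hcl : (𝓝[S ∩ Iio c] c).NeBot := by
          rw [← mem_closure_iff_nhdsWithin_neBot, Metric.mem_closure_iff]
          intro δ hδ
          obtain ⟨s, hs, h1, h2⟩ := hS.exists_mem_Ioo_of_rho_eq hac hρ (sub_lt_self c hδ)
          exact ⟨s, ⟨hs, h2⟩, by rw [Real.dist_eq, abs_of_pos] <;> linarith⟩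
        have ht : Tendsto F (𝓝[S ∩ Iio c] c) (𝓝 (F c)) :=
          ((hF c hck).tendsto hcS).mono_left (nhdsWithin_mono _ inter_subset_left)
        have h1 : |F c - F a| ≤ ε * (c - a) := by
          refine le_of_tendsto_of_tendsto (ht.sub_const (F a)).abs
            (((tendsto_id.mono_left nhdsWithin_le_nhds).sub_const a).const_mul ε) ?_
          filter_upwards [self_mem_nhdsWithin] with s hs using hbelow s hs.1 hs.2
        exact absurd hcB.2 (not_lt.2 h1)
    · have hcle : |F c - F a| ≤ ε * (c - a) := by
        by_contra! h
        exact hcB ⟨hcS, h⟩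
      have hcb : c < b := by
        obtain ⟨s, hs⟩ := hBne
        have h1 : c ≤ s := csInf_le hBbdd hs
        rcases h1.lt_or_eq with h | h
        · exact h.trans_le (hS.greatest.2 hs.1)
        · exact absurd (h ▸ hs) hcB
      have hck := hS.mem_kappa_of_lt hcS hcb
      obtain ⟨δ, hδ, H⟩ := hF c hck ε hε
      have hlt : c < min (c + δ) (if sigma S c = c then c + δ else sigma S c) := by
        refine lt_min (by linarith) ?_
        split_ifs with h
        · linarith
        · exact lt_of_le_of_ne (hS.le_sigma hcS) (Ne.symm h)
      obtain ⟨s, hsB, hs⟩ := exists_lt_of_csInf_lt hBne hlt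
      have hcs : c < s := lt_of_le_of_ne (csInf_le hBbdd hsB) fun h => hcB (h ▸ hsB)
      have hσ : sigma S c = c := by
        by_contra hne
        have h2 := hs.trans_le (min_le_right _ _)
        rw [if_neg hne] at h2
        exact absurd (hS.sigma_le hsB.1 hcs) (not_le.2 h2)
      have h1 := H s hsB.1 (by
        rw [abs_of_pos (by linarith)]
        linarith [hs.trans_le (min_le_left _ _)])
      rw [hσ, zero_mul, sub_zero, abs_sub_comm c s, abs_of_pos (show 0 < s - c by linarith),
        abs_sub_comm] at h1
      have h3 := hsB.2
      have h4 := abs_sub_le (F s) (F c) (F a)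
      nlinarith
  have h : Tendsto (fun ε : ℝ => ε * (t - a)) (𝓝[>] 0) (𝓝 (0 * (t - a))) :=
    (tendsto_id.mul_const _).mono_left nhdsWithin_le_nhds
  have := ge_of_tendsto h (eventually_mem_nhdsWithin.mono fun ε hε => main ε hε t ht)
  rw [zero_mul] at this
  exact sub_eq_zero.1 (abs_nonpos_iff.1 this)

/-! ### Rd-continuous functions -/


lemma RdContinuousOn.congr {A : Set ℝ} {f g : ℝ → ℝ} (hf : RdContinuousOn S A f)
    (h : EqOn f g A) : RdContinuousOn S A g := fun t ht => by
  refine ⟨fun hσ => ((hf t ht).1 hσ).congr (fun x hx => (h hx).symm) (h ht).symm, fun hρ => ?_⟩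
  obtain ⟨m, hm⟩ := (hf t ht).2 hρ
  refine ⟨m, hm.congr' ?_⟩
  filter_upwards [self_mem_nhdsWithin] with x hx using h hx.1

lemma RdContinuousOn.add {A : Set ℝ} {f g : ℝ → ℝ} (hf : RdContinuousOn S A f)
    (hg : RdContinuousOn S A g) : RdContinuousOn S A (fun t => f t + g t) := fun t ht => by
  refine ⟨fun hσ => ((hf t ht).1 hσ).add ((hg t ht).1 hσ), fun hρ => ?_⟩
  obtain ⟨m, hm⟩ := (hf t ht).2 hρ
  obtain ⟨n, hn⟩ := (hg t ht).2 hρ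
  exact ⟨m + n, hm.add hn⟩

lemma RdContinuousOn.mul {A : Set ℝ} {f g : ℝ → ℝ} (hf : RdContinuousOn S A f)
    (hg : RdContinuousOn S A g) : RdContinuousOn S A (fun t => f t * g t) := fun t ht => by
  refine ⟨fun hσ => ((hf t ht).1 hσ).mul ((hg t ht).1 hσ), fun hρ => ?_⟩
  obtain ⟨m, hm⟩ := (hf t ht).2 hρ
  obtain ⟨n, hn⟩ := (hg t ht).2 hρ
  exact ⟨m * n, hm.mul hn⟩

lemma rdContinuousOn_of_tendsto {f : ℝ → ℝ}
    (hf : ∀ t ∈ kappa S, Tendsto f (𝓝[kappa S] t) (𝓝 (f t))) : RdContinuousOn S (kappa S) f :=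
  fun t ht => ⟨fun _ => hf t ht,
    fun _ => ⟨f t, (hf t ht).mono_left (nhdsWithin_mono _ inter_subset_left)⟩⟩

lemma _root_.Continuous.rdContinuousOn {f : ℝ → ℝ} (hf : Continuous f) :
    RdContinuousOn S (kappa S) f :=
  rdContinuousOn_of_tendsto fun t _ => (hf.tendsto t).mono_left nhdsWithin_le_nhds

lemma RdContinuousOn.const_mul {A : Set ℝ} {f : ℝ → ℝ} (c : ℝ) (hf : RdContinuousOn S A f) :
    RdContinuousOn S A (fun t => c * f t) := fun t ht => by
  refine ⟨fun hσ => ((hf t ht).1 hσ).const_mul c, fun hρ => ?_⟩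
  obtain ⟨m, hm⟩ := (hf t ht).2 hρ
  exact ⟨c * m, hm.const_mul c⟩

lemma RdContinuousOn.sub {A : Set ℝ} {f g : ℝ → ℝ} (hf : RdContinuousOn S A f)
    (hg : RdContinuousOn S A g) : RdContinuousOn S A (fun t => f t - g t) :=
  (hf.add (hg.const_mul (-1))).congr fun t _ => by ring

lemma kappa_subset : kappa S ⊆ S := fun _ h => h.1

lemma RdContinuousOn.exists_tendsto_left (hS : IsCompactScale S a b) {f : ℝ → ℝ}
    (hf : RdContinuousOn S (kappa S) f) {t : ℝ} (ht : t ∈ S) :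
    ∃ m, Tendsto f (𝓝[kappa S ∩ Iio t] t) (𝓝 m) := by
  rcases (hS.rho_le ht).lt_or_eq with h | h
  · have := hS.nhdsLT_eq_bot h
    have : 𝓝[kappa S ∩ Iio t] t = ⊥ :=
      le_bot_iff.1 (this ▸ nhdsWithin_mono _ (inter_subset_inter_left _ kappa_subset))
    exact ⟨0, this ▸ tendsto_bot⟩
  · exact (hf t ⟨ht, Or.inr h⟩).2 h

lemma RdContinuousOn.tendsto_right (hS : IsCompactScale S a b) {f : ℝ → ℝ}
    (hf : RdContinuousOn S (kappa S) f) {t : ℝ} (ht : t ∈ S) :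
    Tendsto f (𝓝[kappa S ∩ Ioi t] t) (𝓝 (f t)) := by
  rcases (hS.le_sigma ht).lt_or_eq with h | h
  · have := hS.nhdsGT_eq_bot h
    have : 𝓝[kappa S ∩ Ioi t] t = ⊥ :=
      le_bot_iff.1 (this ▸ nhdsWithin_mono _ (inter_subset_inter_left _ kappa_subset))
    exact this ▸ tendsto_bot
  rcases (hS.greatest.2 ht).lt_or_eq with htb | htb
  · exact ((hf t (hS.mem_kappa_of_lt ht htb)).1 h.symm).mono_left
      (nhdsWithin_mono _ inter_subset_left)
  · have : kappa S ∩ Ioi t = ∅ := by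
      ext s
      simp only [mem_inter_iff, mem_Ioi, mem_empty_iff_false, iff_false, not_and, not_lt]
      exact fun hs => htb ▸ hS.greatest.2 hs.1
    rw [this, nhdsWithin_empty]
    exact tendsto_bot

/-- Rd-continuous functions on a compact time scale are bounded. -/
lemma RdContinuousOn.exists_bound (hS : IsCompactScale S a b) {f : ℝ → ℝ}
    (hf : RdContinuousOn S (kappa S) f) : ∃ M, 0 < M ∧ ∀ t ∈ kappa S, |f t| ≤ M := by
  suffices h : ∃ M, ∀ t ∈ S ∩ kappa S, |f t| ≤ M by
    obtain ⟨M, hM⟩ := h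
    exact ⟨max M 1, by positivity, fun t ht => (hM t ⟨ht.1, ht⟩).trans (le_max_left _ _)⟩
  have hloc : ∀ t ∈ S, ∃ M, ∀ᶠ s in 𝓝[kappa S] t, |f s| ≤ M := by
    intro t ht
    obtain ⟨m, hm⟩ := hf.exists_tendsto_left hS ht
    have h1 := hm.abs.eventually (gt_mem_nhds (lt_add_one |m|))
    have h2 := (hf.tendsto_right hS ht).abs.eventually (gt_mem_nhds (lt_add_one |f t|))
    refine ⟨max (|m| + 1) (|f t| + 1), ?_⟩
    rw [eventually_nhdsWithin_iff] at h1 h2 ⊢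
    filter_upwards [h1, h2] with s h1 h2 hs
    rcases lt_trichotomy s t with h | h | h
    · exact (h1 ⟨hs, h⟩).le.trans (le_max_left _ _)
    · rw [h]; exact (lt_add_one _).le.trans (le_max_right _ _)
    · exact (h2 ⟨hs, h⟩).le.trans (le_max_right _ _)
  refine hS.isCompact.induction_on (p := fun U => ∃ M, ∀ t ∈ U ∩ kappa S, |f t| ≤ M) ?_ ?_ ?_ ?_
  · exact ⟨0, by simp⟩
  · rintro U V hUV ⟨M, hM⟩
    exact ⟨M, fun t ht => hM t ⟨hUV ht.1, ht.2⟩⟩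
  · rintro U V ⟨M, hM⟩ ⟨N, hN⟩
    refine ⟨max M N, ?_⟩
    rintro t ⟨ht | ht, hk⟩
    · exact (hM t ⟨ht, hk⟩).trans (le_max_left _ _)
    · exact (hN t ⟨ht, hk⟩).trans (le_max_right _ _)
  · intro t ht
    obtain ⟨M, hM⟩ := hloc t ht
    rw [eventually_nhdsWithin_iff] at hM
    exact ⟨{s | s ∈ kappa S → |f s| ≤ M}, mem_nhdsWithin_of_mem_nhds hM, M,
      fun s hs => hs.1 hs.2⟩

/-- If `f` is continuous on `S`, then `f ∘ σ` is rd-continuous. -/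
lemma rdContinuousOn_comp_sigma (hS : IsCompactScale S a b) {f : ℝ → ℝ}
    (hf : ∀ t ∈ kappa S, Tendsto f (𝓝[S] t) (𝓝 (f t))) :
    RdContinuousOn S (kappa S) (fun t => f (sigma S t)) := by
  intro t ht
  have h := (hf t ht).comp (hS.tendsto_sigma ht.1)
  constructor
  · intro hσ
    rw [← continuousWithinAt_sdiff_self]
    show Tendsto _ _ (𝓝 (f (sigma S t)))
    rw [hσ]
    exact h.mono_left (nhdsWithin_mono _ (sdiff_subset_sdiff_left kappa_subset))
  · intro _
    exact ⟨f t, h.mono_left (nhdsWithin_mono _ fun s hs => ⟨hs.1.1, hs.2.ne⟩)⟩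

/-! ### The delta integral as a Lebesgue integral -/

/-- The last point of `S` that is not after `x`. Composition with it extends a function on the time
scale to a step-like function on the real line whose Lebesgue integral is the `Δ`-integral. -/
noncomputable def lastPoint (S : Set ℝ) (x : ℝ) : ℝ := sSup (S ∩ Iic x)

namespace IsCompactScale

lemma isGreatest_lastPoint (hS : IsCompactScale S a b) {x : ℝ} (hx : a ≤ x) :
    IsGreatest (S ∩ Iic x) (lastPoint S x) :=
  (hS.isCompact.inter_right isClosed_Iic).isGreatest_sSup ⟨a, hS.least.1, hx⟩

lemma lastPoint_le (hS : IsCompactScale S a b) {x : ℝ} (hx : a ≤ x) : lastPoint S x ≤ x :=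
  (hS.isGreatest_lastPoint hx).1.2

lemma lastPoint_eq (hS : IsCompactScale S a b) {t x : ℝ} (ht : t ∈ S) (h : t ≤ x)
    (h2 : ∀ s ∈ S, s ≤ x → s ≤ t) : lastPoint S x = t :=
  (hS.isGreatest_lastPoint ((hS.least.2 ht).trans h)).unique
    ⟨⟨ht, h⟩, fun s hs => h2 s hs.1 hs.2⟩

lemma le_lastPoint (hS : IsCompactScale S a b) {s x : ℝ} (hs : s ∈ S) (h : s ≤ x) :
    s ≤ lastPoint S x :=
  (hS.isGreatest_lastPoint ((hS.least.2 hs).trans h)).2 ⟨hs, h⟩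

lemma lastPoint_mem (hS : IsCompactScale S a b) {x : ℝ} (hx : a ≤ x) : lastPoint S x ∈ S :=
  (hS.isGreatest_lastPoint hx).1.1

lemma lastPoint_mem_kappa (hS : IsCompactScale S a b) {x : ℝ} (hx : x ∈ Ico a b) :
    lastPoint S x ∈ kappa S :=
  hS.mem_kappa_of_lt (hS.lastPoint_mem hx.1) ((hS.lastPoint_le hx.1).trans_lt hx.2)

end IsCompactScale

lemma RdContinuousOn.continuousWithinAt_lastPoint (hS : IsCompactScale S a b) {f : ℝ → ℝ}
    (hf : RdContinuousOn S (kappa S) f) {x : ℝ} (hx : x ∈ Ico a b) :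
    ContinuousWithinAt (fun x => f (lastPoint S x)) (Ioi x) x := by
  set t := lastPoint S x
  have htS : t ∈ S := hS.lastPoint_mem hx.1
  have htx : t ≤ x := hS.lastPoint_le hx.1
  by_cases hlt : x < sigma S t
  · have : ∀ᶠ z in 𝓝[>] x, f (lastPoint S z) = f t := by
      filter_upwards [self_mem_nhdsWithin, nhdsWithin_le_nhds (isOpen_Iio.mem_nhds hlt)]
        with z hz hz2
      rw [hS.lastPoint_eq htS (htx.trans (le_of_lt hz))]
      intro s hs hsz
      by_contra! h
      exact absurd (hS.sigma_le hs h) (not_le.2 (hsz.trans_lt hz2))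
    exact (tendsto_const_nhds (x := f t)).congr' (this.mono fun _ h => h.symm)
  -- otherwise `x` is itself a right-dense point of `S`
  have hσx : sigma S t ≤ x := not_lt.1 hlt
  have hσt : sigma S t = t :=
    le_antisymm (hS.le_lastPoint (hS.sigma_mem t) hσx) (hS.le_sigma htS)
  have hxt : t = x := by
    refine le_antisymm htx ?_
    by_contra! h
    obtain ⟨s, hs, h1, h2⟩ := hS.exists_mem_Ioo_of_sigma_eq (htx.trans_lt hx.2) hσt h
    exact absurd (hS.le_lastPoint hs h2.le) (not_le.2 h1)
  have hc := (hf t (hS.mem_kappa_of_lt htS (htx.trans_lt hx.2))).1 hσt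
  have hlp : Tendsto (lastPoint S) (𝓝[>] x) (𝓝[kappa S] t) := by
    refine tendsto_nhdsWithin_of_tendsto_nhds_of_eventually_within _ ?_ ?_
    · refine tendsto_of_tendsto_of_tendsto_of_le_of_le' (g := fun _ => t) (h := fun z => z)
        tendsto_const_nhds (hxt ▸ tendsto_id.mono_left nhdsWithin_le_nhds) ?_ ?_
      · filter_upwards [self_mem_nhdsWithin] with z hz
        exact hS.le_lastPoint htS (htx.trans (le_of_lt hz))
      · filter_upwards [self_mem_nhdsWithin] with z hz
        exact hS.lastPoint_le (hx.1.trans (le_of_lt hz))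
    · filter_upwards [self_mem_nhdsWithin, nhdsWithin_le_nhds (isOpen_Iio.mem_nhds hx.2)]
        with z hz hz2
      exact hS.lastPoint_mem_kappa ⟨hx.1.trans (le_of_lt hz), hz2⟩
  exact hc.tendsto.comp hlp

/-- A right-continuous function is measurable: it is the limit of its values at the next point of
the grid `ℤ / (n + 1)`. -/
lemma measurable_of_continuousWithinAt_Ioi {φ : ℝ → ℝ}
    (h : ∀ x, ContinuousWithinAt φ (Ioi x) x) : Measurable φ := by
  refine measurable_of_tendsto_metrizable
    (f := fun (n : ℕ) x => φ ((⌊((n : ℝ) + 1) * x⌋ + 1) / ((n : ℝ) + 1))) (fun n => ?_) ?_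
  · have h1 : Measurable fun k : ℤ => φ (((k : ℝ) + 1) / ((n : ℝ) + 1)) := measurable_from_top
    exact h1.comp (Int.measurable_floor.comp (measurable_const_mul _))
  · rw [tendsto_pi_nhds]
    intro x
    refine (h x).tendsto.comp (tendsto_nhdsWithin_of_tendsto_nhds_of_eventually_within _ ?_ ?_)
    · refine tendsto_of_tendsto_of_tendsto_of_le_of_le (g := fun _ => x)
        (h := fun n : ℕ => x + 1 / ((n : ℝ) + 1)) tendsto_const_nhds ?_ ?_ ?_
      · simpa using (tendsto_one_div_add_atTop_nhds_zero_nat (𝕜 := ℝ)).const_add x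
      · intro n
        have hn : (0 : ℝ) < (n : ℝ) + 1 := by positivity
        show x ≤ _
        rw [le_div_iff₀ hn, mul_comm]
        exact (Int.lt_floor_add_one _).le
      · intro n
        have hn : (0 : ℝ) < (n : ℝ) + 1 := by positivity
        show _ ≤ x + 1 / ((n : ℝ) + 1)
        have h1 : (x + 1 / ((n : ℝ) + 1)) * ((n : ℝ) + 1) = ((n : ℝ) + 1) * x + 1 := by
          field_simp
        rw [div_le_iff₀ hn, h1]
        linarith [Int.floor_le (((n : ℝ) + 1) * x)]
    · refine Eventually.of_forall fun n => ?_
      have hn : (0 : ℝ) < (n : ℝ) + 1 := by positivity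
      show x < _
      rw [lt_div_iff₀ hn, mul_comm]
      exact Int.lt_floor_add_one _

lemma RdContinuousOn.intervalIntegrable (hS : IsCompactScale S a b) {f : ℝ → ℝ}
    (hf : RdContinuousOn S (kappa S) f) {s r : ℝ} (hs : s ∈ S) (hr : r ∈ S) :
    IntervalIntegrable (fun x => f (lastPoint S x)) MeasureTheory.volume s r := by
  suffices h : IntervalIntegrable (fun x => f (lastPoint S x)) MeasureTheory.volume a b by
    refine h.mono_set ?_
    rw [uIcc_of_le hS.lt.le]
    exact uIcc_subset_Icc ⟨hS.least.2 hs, hS.greatest.2 hs⟩ ⟨hS.least.2 hr, hS.greatest.2 hr⟩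
  rw [intervalIntegrable_iff_integrableOn_Ico_of_le hS.lt.le]
  obtain ⟨M, -, hM⟩ := hf.exists_bound hS
  have hmeas : Measurable ((Ico a b).indicator fun x => f (lastPoint S x)) := by
    refine measurable_of_continuousWithinAt_Ioi fun x => ?_
    by_cases hx : x ∈ Ico a b
    · refine (hf.continuousWithinAt_lastPoint hS hx).congr_of_eventuallyEq ?_
        (indicator_of_mem hx _)
      filter_upwards [self_mem_nhdsWithin, nhdsWithin_le_nhds (isOpen_Iio.mem_nhds hx.2)]
        with z hz hz2
      exact indicator_of_mem (show z ∈ Ico a b from ⟨hx.1.trans (mem_Ioi.1 hz).le, hz2⟩) _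
    · have h0 : ∀ᶠ z in 𝓝[>] x, (Ico a b).indicator (fun x => f (lastPoint S x)) z = 0 := by
        rcases lt_or_ge x a with h | h
        · filter_upwards [nhdsWithin_le_nhds (isOpen_Iio.mem_nhds h)] with z hz
          exact indicator_of_notMem (fun h => absurd h.1 (not_le.2 hz)) _
        · have hbx : b ≤ x := by by_contra! hc; exact hx ⟨h, hc⟩
          filter_upwards [self_mem_nhdsWithin] with z hz
          exact indicator_of_notMem (fun h => absurd h.2 (not_lt.2 (hbx.trans (mem_Ioi.1 hz).le))) _
      exact (continuousWithinAt_const (b := (0 : ℝ))).congr_of_eventuallyEq h0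
        (indicator_of_notMem hx _)
  refine MeasureTheory.Integrable.of_bound (C := M) ?_ ?_
  · have := hmeas.aestronglyMeasurable (μ := MeasureTheory.volume.restrict (Ico a b))
    refine this.congr ?_
    filter_upwards [MeasureTheory.ae_restrict_mem measurableSet_Ico] with x hx
    exact indicator_of_mem hx _
  · filter_upwards [MeasureTheory.ae_restrict_mem measurableSet_Ico] with x hx
    exact hM _ (hS.lastPoint_mem_kappa hx)

/-- If `f` is `ε`-close to `m` on `[s,r)`, its integral over `[s,r]` is `ε (r - s)`-close to
`m (r - s)`. -/
lemma abs_integral_lastPoint_sub_le (hS : IsCompactScale S a b) {f : ℝ → ℝ}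
    (hf : RdContinuousOn S (kappa S) f) {s r m ε : ℝ} (hs : s ∈ S) (hr : r ∈ S) (hsr : s ≤ r)
    (h : ∀ t ∈ kappa S, s ≤ t → t < r → |f t - m| ≤ ε) :
    |(∫ x in s..r, f (lastPoint S x)) - m * (r - s)| ≤ ε * (r - s) := by
  have hi := hf.intervalIntegrable hS hs hr
  have h1 : (∫ x in s..r, f (lastPoint S x)) - m * (r - s)
      = ∫ x in s..r, (f (lastPoint S x) - m) := by
    rw [intervalIntegral.integral_sub hi intervalIntegrable_const,
      intervalIntegral.integral_const, smul_eq_mul, mul_comm]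
  rw [h1]
  have h2 := intervalIntegral.norm_integral_le_of_norm_le_const_ae (a := s) (b := r) (C := ε)
    (f := fun x => f (lastPoint S x) - m) ?_
  · rwa [Real.norm_eq_abs, abs_of_nonneg (sub_nonneg.2 hsr)] at h2
  have hne : ∀ᵐ x : ℝ, x ≠ r := by simp [MeasureTheory.ae_iff, MeasureTheory.measure_singleton]
  filter_upwards [hne] with x hxr hx
  rw [uIoc_of_le hsr] at hx
  have hlt : x < r := lt_of_le_of_ne hx.2 hxr
  have hax : a ≤ x := (hS.least.2 hs).trans hx.1.le
  exact h _ (hS.lastPoint_mem_kappa ⟨hax, hlt.trans_le (hS.greatest.2 hr)⟩)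
    (hS.le_lastPoint hs hx.1.le) ((hS.lastPoint_le hax).trans_lt hlt)

/-- The fundamental theorem of calculus on a time scale. -/
lemma hasDeltaDerivAt_integral (hS : IsCompactScale S a b) {f : ℝ → ℝ}
    (hf : RdContinuousOn S (kappa S) f) {c t : ℝ} (hc : c ∈ S) (ht : t ∈ kappa S) :
    HasDeltaDerivAt S (fun s => ∫ x in c..s, f (lastPoint S x)) (f t) t := by
  intro ε hε
  have hsub : ∀ s ∈ S, ∀ r ∈ S, (∫ x in c..r, f (lastPoint S x)) - (∫ x in c..s, f (lastPoint S x))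
      = ∫ x in s..r, f (lastPoint S x) := fun s hs r hr =>
    intervalIntegral.integral_interval_sub_left (hf.intervalIntegrable hS hc hr)
      (hf.intervalIntegrable hS hc hs)
  rcases (hS.le_sigma ht.1).lt_or_eq with hσ | hσ
  · obtain ⟨M, hM, hfM⟩ := hf.exists_bound hS
    have hd : 0 < sigma S t - t := sub_pos.2 hσ
    refine ⟨min (sigma S t - t) (ε * (sigma S t - t) / (2 * M)), by positivity, ?_⟩
    intro s hs hst
    have h1 := hst.trans_le (min_le_left _ _)
    have h2 := hst.trans_le (min_le_right _ _)
    have hle : s ≤ t := by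
      by_contra! h
      rw [abs_of_pos (sub_pos.2 h)] at h1
      linarith [hS.sigma_le hs h]
    simp only
    rw [hsub s hs _ (hS.sigma_mem t)]
    have e1 : |(∫ x in t..sigma S t, f (lastPoint S x)) - f t * (sigma S t - t)| ≤
        0 * (sigma S t - t) :=
      abs_integral_lastPoint_sub_le hS hf ht.1 (hS.sigma_mem t) hσ.le fun r hr h h' => by
        have : r = t := le_antisymm (by
          by_contra! hlt
          exact absurd (hS.sigma_le hr.1 hlt) (not_le.2 h')) h
        simp [this]
    have e2 := abs_integral_lastPoint_sub_le hS hf (m := f t) (ε := 2 * M) hs ht.1 hle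
      fun r hr _ _ => by
        have := abs_sub (f r) (f t)
        have := hfM r hr
        have := hfM t ht
        linarith
    have e3 : (∫ x in s..t, f (lastPoint S x)) + (∫ x in t..sigma S t, f (lastPoint S x))
        = ∫ x in s..sigma S t, f (lastPoint S x) :=
      intervalIntegral.integral_add_adjacent_intervals (hf.intervalIntegrable hS hs ht.1)
        (hf.intervalIntegrable hS ht.1 (hS.sigma_mem t))
    rw [zero_mul] at e1
    have e4 := sub_eq_zero.1 (abs_nonpos_iff.1 e1)
    rw [abs_of_nonpos (by linarith), lt_div_iff₀ (by positivity)] at h2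
    rw [← e3, e4, abs_of_pos (show 0 < sigma S t - s by linarith)]
    have e5 : (∫ x in s..t, f (lastPoint S x)) + f t * (sigma S t - t) - f t * (sigma S t - s)
        = (∫ x in s..t, f (lastPoint S x)) - f t * (t - s) := by ring
    rw [e5]
    nlinarith
  · have hcont := (hf t ht).1 hσ.symm
    obtain ⟨δ, hδ, H⟩ := Metric.continuousWithinAt_iff.1 hcont ε hε
    refine ⟨δ, hδ, fun s hs hst => ?_⟩
    rw [← hσ]
    simp only
    rw [hsub s hs t ht.1]
    rw [abs_lt] at hst
    rcases le_total s t with h | h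
    · rw [abs_of_nonneg (sub_nonneg.2 h)]
      refine abs_integral_lastPoint_sub_le hS hf hs ht.1 h fun r hr h1 h2 => ?_
      exact (H hr (by rw [Real.dist_eq, abs_lt]; constructor <;> linarith)).le
    · rw [intervalIntegral.integral_symm, abs_sub_comm t s, abs_of_nonneg (sub_nonneg.2 h),
        ← abs_neg]
      have := abs_integral_lastPoint_sub_le hS hf (m := f t) (ε := ε) ht.1 hs h fun r hr h1 h2 =>
        (H hr (by rw [Real.dist_eq, abs_lt]; constructor <;> linarith)).le
      convert this using 2
      ring

lemma integral_lastPoint_eq_sub (hS : IsCompactScale S a b) {F f : ℝ → ℝ}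
    (hf : RdContinuousOn S (kappa S) f) (hF : IsAntiderivative S F f) {s r : ℝ} (hs : s ∈ S)
    (hr : r ∈ S) : ∫ x in s..r, f (lastPoint S x) = F r - F s := by
  have h0 : ∀ t ∈ kappa S,
      HasDeltaDerivAt S (fun t => F t - ∫ x in a..t, f (lastPoint S x)) 0 t := fun t ht => by
    simpa using (hF t ht).sub (hasDeltaDerivAt_integral hS hf hS.least.1 ht)
  have h1 := eq_of_hasDeltaDerivAt_zero hS h0 hs
  have h2 := eq_of_hasDeltaDerivAt_zero hS h0 hr
  rw [← intervalIntegral.integral_interval_sub_left (hf.intervalIntegrable hS hS.least.1 hr)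
    (hf.intervalIntegrable hS hS.least.1 hs)]
  rw [intervalIntegral.integral_same] at h1 h2
  linarith

lemma deltaIntegral_eq (hS : IsCompactScale S a b) {f : ℝ → ℝ}
    (hf : RdContinuousOn S (kappa S) f) {s r : ℝ} (hs : s ∈ S) (hr : r ∈ S) :
    deltaIntegral S f s r = ∫ x in s..r, f (lastPoint S x) := by
  have h : ∃ F : ℝ → ℝ, IsAntiderivative S F f :=
    ⟨_, fun t ht => hasDeltaDerivAt_integral hS hf hS.least.1 ht⟩
  rw [deltaIntegral, dif_pos h, integral_lastPoint_eq_sub hS hf h.choose_spec hs hr]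

lemma integral_lastPoint_congr (hS : IsCompactScale S a b) {f g : ℝ → ℝ}
    (h : EqOn f g (kappa S)) {s r : ℝ} (hs : s ∈ S) (hr : r ∈ S) (hsr : s ≤ r) :
    ∫ x in s..r, f (lastPoint S x) = ∫ x in s..r, g (lastPoint S x) := by
  rw [intervalIntegral.integral_of_le hsr, intervalIntegral.integral_of_le hsr,
    ← MeasureTheory.integral_Ico_eq_integral_Ioc, ← MeasureTheory.integral_Ico_eq_integral_Ioc]
  refine MeasureTheory.setIntegral_congr_fun measurableSet_Ico fun x hx => h ?_
  exact hS.lastPoint_mem_kappa ⟨(hS.least.2 hs).trans hx.1, hx.2.trans_le (hS.greatest.2 hr)⟩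

/-! ### The class of rd-continuously differentiable functions -/

lemma isC1rd_of_hasDeltaDerivAt (hS : IsCompactScale S a b) {y h : ℝ → ℝ}
    (hy : ∀ t ∈ kappa S, HasDeltaDerivAt S y (h t) t) (hh : RdContinuousOn S (kappa S) h) :
    IsC1rd S y :=
  ⟨fun t ht => ⟨_, hy t ht⟩, hh.congr fun t ht => ((hy t ht).deltaDeriv_eq hS ht).symm⟩

lemma IsC1rd.hasDeltaDerivAt {y : ℝ → ℝ} (hy : IsC1rd S y) {t : ℝ} (ht : t ∈ kappa S) :
    HasDeltaDerivAt S y (deltaDeriv S y t) t := (hy.1 t ht).hasDeltaDerivAt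

lemma IsC1rd.tendsto {y : ℝ → ℝ} (hy : IsC1rd S y) {t : ℝ} (ht : t ∈ kappa S) :
    Tendsto y (𝓝[S] t) (𝓝 (y t)) := (hy.hasDeltaDerivAt ht).tendsto ht.1

lemma IsC1rd.rdContinuousOn {y : ℝ → ℝ} (hy : IsC1rd S y) : RdContinuousOn S (kappa S) y :=
  rdContinuousOn_of_tendsto fun _ ht => (hy.tendsto ht).mono_left (nhdsWithin_mono _ kappa_subset)

lemma IsC1rd.rdContinuousOn_sigma (hS : IsCompactScale S a b) {y : ℝ → ℝ} (hy : IsC1rd S y) :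
    RdContinuousOn S (kappa S) (fun t => y (sigma S t)) :=
  rdContinuousOn_comp_sigma hS fun _ ht => hy.tendsto ht

lemma IsC1rd.add (hS : IsCompactScale S a b) {y z : ℝ → ℝ} (hy : IsC1rd S y) (hz : IsC1rd S z) :
    IsC1rd S (fun t => y t + z t) :=
  isC1rd_of_hasDeltaDerivAt hS (fun _ ht => (hy.hasDeltaDerivAt ht).add (hz.hasDeltaDerivAt ht))
    (hy.2.add hz.2)

lemma IsC1rd.const_mul (hS : IsCompactScale S a b) {y : ℝ → ℝ} (c : ℝ) (hy : IsC1rd S y) :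
    IsC1rd S (fun t => c * y t) :=
  isC1rd_of_hasDeltaDerivAt hS (fun _ ht => (hy.hasDeltaDerivAt ht).const_mul c) (hy.2.const_mul c)

lemma IsC1rd.mul (hS : IsCompactScale S a b) {y z : ℝ → ℝ} (hy : IsC1rd S y) (hz : IsC1rd S z) :
    IsC1rd S (fun t => y t * z t) :=
  isC1rd_of_hasDeltaDerivAt hS
    (fun _ ht => (hy.hasDeltaDerivAt ht).mul ht.1 (hz.hasDeltaDerivAt ht))
    ((hy.2.mul (hz.rdContinuousOn_sigma hS)).add (hy.rdContinuousOn.mul hz.2))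

lemma isC1rd_integral (hS : IsCompactScale S a b) {f : ℝ → ℝ} (hf : RdContinuousOn S (kappa S) f)
    {c : ℝ} (hc : c ∈ S) : IsC1rd S (fun t => ∫ x in c..t, f (lastPoint S x)) :=
  isC1rd_of_hasDeltaDerivAt hS (fun _ ht => hasDeltaDerivAt_integral hS hf hc ht) hf

lemma isC1rd_const (hS : IsCompactScale S a b) (c : ℝ) : IsC1rd S (fun _ => c) :=
  isC1rd_of_hasDeltaDerivAt hS (h := fun _ => 0) (fun t _ => hasDeltaDerivAt_const S c t)
    continuous_const.rdContinuousOn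

lemma isC1rd_id (hS : IsCompactScale S a b) : IsC1rd S (fun t => t) :=
  isC1rd_of_hasDeltaDerivAt hS (h := fun _ => 1) (fun t _ => hasDeltaDerivAt_id S t)
    continuous_const.rdContinuousOn

/-! ### Equicontinuity of the partial derivatives of a regular integrand -/

/-- The derivative of `L(t,·,·)` at `(u,v)` in the direction `(η^σ(t), η^Δ(t))`. -/
noncomputable def dirDeriv (S : Set ℝ) (L : ℝ → ℝ → ℝ → ℝ) (η : ℝ → ℝ) (t u v : ℝ) : ℝ :=
  partialU L t u v * η (sigma S t) + partialV L t u v * deltaDeriv S η t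

namespace IsRegularIntegrand

variable {L : ℝ → ℝ → ℝ → ℝ}

lemma hasFDerivAt (hL : IsRegularIntegrand S L) {t : ℝ} (ht : t ∈ kappa S) (u v : ℝ) :
    HasFDerivAt (fun p : ℝ × ℝ => L t p.1 p.2) (fderiv ℝ (fun p : ℝ × ℝ => L t p.1 p.2) (u, v))
      (u, v) :=
  ((hL.contDiff t ht).differentiable (by norm_num) (u, v)).hasFDerivAt

lemma hasDerivAt_u (hL : IsRegularIntegrand S L) {t : ℝ} (ht : t ∈ kappa S) (u v : ℝ) :
    HasDerivAt (fun x => L t x v) (partialU L t u v) u := by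
  have h := (hL.hasFDerivAt ht u v).comp_hasDerivAt u
    ((hasDerivAt_id u).prodMk (hasDerivAt_const u v))
  exact h.differentiableAt.hasDerivAt

lemma hasDerivAt_v (hL : IsRegularIntegrand S L) {t : ℝ} (ht : t ∈ kappa S) (u v : ℝ) :
    HasDerivAt (fun x => L t u x) (partialV L t u v) v := by
  have h := (hL.hasFDerivAt ht u v).comp_hasDerivAt v
    ((hasDerivAt_const v u).prodMk (hasDerivAt_id v))
  exact h.differentiableAt.hasDerivAt

lemma fderiv_apply (hL : IsRegularIntegrand S L) {t : ℝ} (ht : t ∈ kappa S) (u v h k : ℝ) :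
    fderiv ℝ (fun p : ℝ × ℝ => L t p.1 p.2) (u, v) (h, k)
      = partialU L t u v * h + partialV L t u v * k := by
  set A := fderiv ℝ (fun p : ℝ × ℝ => L t p.1 p.2) (u, v)
  have hA : HasFDerivAt (fun p : ℝ × ℝ => L t p.1 p.2) A (u, v) := hL.hasFDerivAt ht u v
  have hu0 := hA.comp_hasDerivAt u ((hasDerivAt_id' u).prodMk (hasDerivAt_const u v))
  have hu : HasDerivAt (fun x => L t x v) (A (1, 0)) u := hu0
  have hv0 := hA.comp_hasDerivAt v ((hasDerivAt_const v u).prodMk (hasDerivAt_id' v))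
  have hv : HasDerivAt (fun x => L t u x) (A (0, 1)) v := hv0
  have e : ((h, k) : ℝ × ℝ) = h • ((1 : ℝ), (0 : ℝ)) + k • ((0 : ℝ), (1 : ℝ)) := by
    ext <;> simp
  rw [e, map_add, map_smul, map_smul, hu.unique (hL.hasDerivAt_u ht u v),
    hv.unique (hL.hasDerivAt_v ht u v)]
  simp only [smul_eq_mul]
  ring

lemma continuous_partials (hL : IsRegularIntegrand S L) {t : ℝ} (ht : t ∈ kappa S) :
    Continuous (fun p : ℝ × ℝ => partialU L t p.1 p.2) ∧
      Continuous (fun p : ℝ × ℝ => partialV L t p.1 p.2) := by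
  have hc := (hL.contDiff t ht).continuous_fderiv (by norm_num)
  constructor
  · refine (hc.clm_apply (continuous_const (y := ((1 : ℝ), (0 : ℝ))))).congr fun p => ?_
    rw [hL.fderiv_apply ht]; ring
  · refine (hc.clm_apply (continuous_const (y := ((0 : ℝ), (1 : ℝ))))).congr fun p => ?_
    rw [hL.fderiv_apply ht]; ring

lemma deriv_alongLine (hL : IsRegularIntegrand S L) {t : ℝ} (ht : t ∈ kappa S) (y η : ℝ → ℝ)
    (ε : ℝ) : deriv (alongLine S L y η t) ε =
      dirDeriv S L η t (y (sigma S t) + ε * η (sigma S t))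
        (deltaDeriv S y t + ε * deltaDeriv S η t) := by
  have h := (hL.hasFDerivAt ht (y (sigma S t) + ε * η (sigma S t))
      (deltaDeriv S y t + ε * deltaDeriv S η t)).comp_hasDerivAt ε
    ((((hasDerivAt_id ε).mul_const (η (sigma S t))).const_add (y (sigma S t))).prodMk
      (((hasDerivAt_id ε).mul_const (deltaDeriv S η t)).const_add (deltaDeriv S y t)))
  rw [hL.fderiv_apply ht, one_mul, one_mul] at h
  exact h.deriv

lemma rd_dirDeriv (hS : IsCompactScale S a b) (hL : IsRegularIntegrand S L) {y η : ℝ → ℝ}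
    (hy : IsC1rd S y) (hη : IsC1rd S η) : RdContinuousOn S (kappa S)
      (fun t => dirDeriv S L η t (y (sigma S t)) (deltaDeriv S y t)) :=
  ((hL.rd_u y hy).mul (hη.rdContinuousOn_sigma hS)).add ((hL.rd_v y hy).mul hη.2)

/-- A perturbation `(α_n, β_n) → 0` of `[y]` along a sequence `t_n` of distinct points is realised
by some line `ε ↦ z + ε η` with `z ∈ C¹_rd`, at parameters `s_n → 0`. Uniform continuity along that
line then makes the directional derivative converge along the perturbed points. -/
lemma exists_tendsto_dirDeriv (hS : IsCompactScale S a b) (hL : IsRegularIntegrand S L)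
    {y η : ℝ → ℝ} (hy : IsC1rd S y) (hη : IsC1rd S η) (hη1 : ∀ t ∈ S, 1 ≤ η t)
    {t : ℕ → ℝ} {t₀ : ℝ} (ht : ∀ n, t n ∈ kappa S) (ht₀ : t₀ ∈ kappa S)
    (hinj : Function.Injective t) (hne : ∀ n, t n ≠ t₀) (hlim : Tendsto t atTop (𝓝 t₀))
    (hconv : ∀ f : ℝ → ℝ, RdContinuousOn S (kappa S) f →
      ∃ m, Tendsto (fun n => f (t n)) atTop (𝓝 m))
    {α β : ℕ → ℝ} (hα : Tendsto α atTop (𝓝 0)) (hβ : Tendsto β atTop (𝓝 0)) :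
    ∃ m, Tendsto (fun n => dirDeriv S L η (t n) (y (sigma S (t n)) + α n)
      (deltaDeriv S y (t n) + β n)) atTop (𝓝 m) := by
  have hσpos : ∀ n, 0 < η (sigma S (t n)) := fun n =>
    lt_of_lt_of_le one_pos (hη1 _ (hS.sigma_mem _))
  have hpos : ∀ n, 0 < η (t n) := fun n => lt_of_lt_of_le one_pos (hη1 _ (ht n).1)
  obtain ⟨m₁, hm₁⟩ := hconv _ (hη.rdContinuousOn_sigma hS)
  obtain ⟨m₂, hm₂⟩ := hconv _ hη.rdContinuousOn
  obtain ⟨m₃, hm₃⟩ := hconv _ hη.2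
  have hm₁0 : m₁ ≠ 0 := by
    have : 1 ≤ m₁ := ge_of_tendsto' hm₁ fun n => hη1 _ (hS.sigma_mem _)
    positivity
  have hm₂0 : m₂ ≠ 0 := by
    have : 1 ≤ m₂ := ge_of_tendsto' hm₂ fun n => hη1 _ (ht n).1
    positivity
  -- with `z = y + η q`, the values that `q^Δ(t_n)` must have for the line to hit the points
  set c : ℕ → ℝ := fun n =>
    (β n - deltaDeriv S η (t n) * (α n / η (sigma S (t n)))) / η (t n) with hc
  have hc0 : Tendsto c atTop (𝓝 0) := by
    have : Tendsto c atTop (𝓝 ((0 - m₃ * (0 / m₁)) / m₂)) :=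
      (hβ.sub (hm₃.mul (hα.div hm₁ hm₁0))).div hm₂ hm₂0
    simpa using this
  -- Tietze extension from the closed set `{t_n} ∪ {t₀}`
  obtain ⟨h, hh⟩ : ∃ h : C(ℝ, ℝ), ∀ n, h (t n) = c n := by
    set τ : C(OnePoint ℕ, ℝ) := OnePoint.continuousMapMkNat t t₀ hlim
    have hτi : Function.Injective τ := by
      intro x x'
      induction x using OnePoint.rec with
      | infty =>
        induction x' using OnePoint.rec with
        | infty => simp
        | coe n => intro h; exact absurd h.symm (hne n)
      | coe m =>
        induction x' using OnePoint.rec with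
        | infty => intro h; exact absurd h (hne m)
        | coe n => intro h; rw [hinj (show t m = t n from h)]
    obtain ⟨h, hh⟩ := ContinuousMap.exists_extension
      (τ.continuous.isClosedEmbedding hτi) (OnePoint.continuousMapMkNat c 0 hc0)
    refine ⟨h, fun n => ?_⟩
    exact congrArg (fun k : C(OnePoint ℕ, ℝ) => k (n : OnePoint ℕ)) hh
  have hrd : RdContinuousOn S (kappa S) h := h.continuous.rdContinuousOn
  set q : ℝ → ℝ := fun s => ∫ x in t₀..s, h (lastPoint S x)
  have hqC : IsC1rd S q := isC1rd_integral hS hrd ht₀.1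
  have hqd : ∀ n, deltaDeriv S q (t n) = c n := fun n => by
    rw [(hasDeltaDerivAt_integral hS hrd ht₀.1 (ht n)).deltaDeriv_eq hS (ht n), hh]
  have hzC : IsC1rd S (fun s => y s + η s * q s) := hy.add hS (hη.mul hS hqC)
  have hzd : ∀ n, deltaDeriv S (fun s => y s + η s * q s) (t n) = deltaDeriv S y (t n) +
      (deltaDeriv S η (t n) * q (sigma S (t n)) + η (t n) * c n) := fun n => by
    rw [← hqd n]
    exact ((hy.hasDeltaDerivAt (ht n)).add ((hη.hasDeltaDerivAt (ht n)).mul (ht n).1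
      (hqC.hasDeltaDerivAt (ht n)))).deltaDeriv_eq hS (ht n)
  have hqσ : Tendsto (fun n => q (sigma S (t n))) atTop (𝓝 0) := by
    have h1 : Tendsto t atTop (𝓝[S \ {t₀}] t₀) :=
      tendsto_nhdsWithin_of_tendsto_nhds_of_eventually_within _ hlim
        (Eventually.of_forall fun n => ⟨(ht n).1, hne n⟩)
    have h2 := (hqC.tendsto ht₀).comp ((hS.tendsto_sigma ht₀.1).comp h1)
    have h3 : q t₀ = 0 := intervalIntegral.integral_same
    rwa [h3] at h2
  set s : ℕ → ℝ := fun n => α n / η (sigma S (t n)) - q (sigma S (t n)) with hs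
  have hs0 : Tendsto s atTop (𝓝 0) := by
    have : Tendsto s atTop (𝓝 (0 / m₁ - 0)) := (hα.div hm₁ hm₁0).sub hqσ
    simpa using this
  obtain ⟨m, hm⟩ := hconv _ (hL.rd_dirDeriv hS hzC hη)
  refine ⟨m, ?_⟩
  have hdiff : Tendsto (fun n => deriv (alongLine S L (fun s => y s + η s * q s) η (t n)) (s n) -
      deriv (alongLine S L (fun s => y s + η s * q s) η (t n)) 0) atTop (𝓝 0) := by
    rw [Metric.tendsto_atTop']
    intro e he
    obtain ⟨δ, hδ, H⟩ := hL.unif_first _ η hzC hη 0 e he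
    obtain ⟨N, hN⟩ := Metric.tendsto_atTop'.1 hs0 δ hδ
    refine ⟨N, fun n hn => ?_⟩
    have h1 := hN n hn
    rw [Real.dist_eq] at h1
    rw [Real.dist_eq, sub_zero]
    exact H _ h1 _ (ht n)
  have hsum := hdiff.add hm
  rw [zero_add] at hsum
  refine hsum.congr fun n => ?_
  rw [hL.deriv_alongLine (ht n), hL.deriv_alongLine (ht n)]
  simp only [zero_mul, add_zero, sub_add_cancel]
  congr 1
  · simp only [hs]
    have := (hσpos n).ne'
    field_simp
    ring
  · rw [hzd]
    simp only [hs, hc]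
    have := (hσpos n).ne'
    have := (hpos n).ne'
    field_simp
    ring

/-- The perturbed and the unperturbed directional derivatives cannot stay apart: by
`exists_tendsto_dirDeriv` both converge along the sequence whose odd terms are left unperturbed. -/
lemma not_forall_le_dirDeriv_sub (hS : IsCompactScale S a b) (hL : IsRegularIntegrand S L)
    {y η : ℝ → ℝ} (hy : IsC1rd S y) (hη : IsC1rd S η) (hη1 : ∀ t ∈ S, 1 ≤ η t)
    {t : ℕ → ℝ} {t₀ : ℝ} (ht : ∀ n, t n ∈ kappa S) (ht₀ : t₀ ∈ kappa S)
    (hinj : Function.Injective t) (hne : ∀ n, t n ≠ t₀) (hlim : Tendsto t atTop (𝓝 t₀))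
    (hconv : ∀ f : ℝ → ℝ, RdContinuousOn S (kappa S) f →
      ∃ m, Tendsto (fun n => f (t n)) atTop (𝓝 m))
    {α β : ℕ → ℝ} (hα : Tendsto α atTop (𝓝 0)) (hβ : Tendsto β atTop (𝓝 0)) {e : ℝ} (he : 0 < e) :
    ¬ ∀ n, e ≤ |dirDeriv S L η (t n) (y (sigma S (t n)) + α n) (deltaDeriv S y (t n) + β n) -
      dirDeriv S L η (t n) (y (sigma S (t n))) (deltaDeriv S y (t n))| := by
  intro hcon
  have hsplit : ∀ γ : ℕ → ℝ, Tendsto γ atTop (𝓝 0) →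
      Tendsto (fun n => if Even n then γ n else 0) atTop (𝓝 0) := fun γ hγ =>
    squeeze_zero_norm (a := fun n => |γ n|) (fun n => by split_ifs <;> simp)
      (by simpa using hγ.abs)
  obtain ⟨m, hm⟩ := hL.exists_tendsto_dirDeriv hS hy hη hη1 ht ht₀ hinj hne hlim hconv
    (hsplit α hα) (hsplit β hβ)
  obtain ⟨m', hm'⟩ := hconv _ (hL.rd_dirDeriv hS hy hη)
  have hdiff := (hm.sub hm')
  have hodd : Tendsto (fun k : ℕ => 2 * k + 1) atTop atTop :=
    tendsto_atTop_mono (f := fun k => k) (fun k => by omega) tendsto_id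
  have heven : Tendsto (fun k : ℕ => 2 * k) atTop atTop :=
    tendsto_atTop_mono (f := fun k => k) (fun k => by omega) tendsto_id
  have h1 := hdiff.comp hodd
  have h2 := (hdiff.comp heven).abs
  have hz : m - m' = 0 := by
    refine tendsto_nhds_unique h1 (tendsto_const_nhds.congr fun k => ?_)
    simp
  rw [hz, abs_zero] at h2
  obtain ⟨k, hk⟩ := (h2.eventually (gt_mem_nhds he)).exists
  have h3 := hcon (2 * k)
  simp only [Function.comp_apply, even_two, Even.mul_right, if_true] at hk
  linarith

/-- For `η ≥ 1`, the derivative of `L` in the direction `[η]` is continuous at `[y](t)`, uniformly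
in `t`. -/
lemma dirDeriv_equicontinuous (hS : IsCompactScale S a b) (hL : IsRegularIntegrand S L)
    {y η : ℝ → ℝ} (hy : IsC1rd S y) (hη : IsC1rd S η) (hη1 : ∀ t ∈ S, 1 ≤ η t)
    {e : ℝ} (he : 0 < e) : ∃ δ : ℝ, 0 < δ ∧ ∀ t ∈ kappa S, ∀ α β : ℝ, |α| < δ → |β| < δ →
      |dirDeriv S L η t (y (sigma S t) + α) (deltaDeriv S y t + β) -
        dirDeriv S L η t (y (sigma S t)) (deltaDeriv S y t)| < e := by
  by_contra! hcon
  choose! t ht α β hα hβ hcon using fun n : ℕ =>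
    hcon (1 / ((n : ℝ) + 1)) (by positivity)
  have hα0 : Tendsto α atTop (𝓝 0) := squeeze_zero_norm (fun n => (hα n).le)
    tendsto_one_div_add_atTop_nhds_zero_nat
  have hβ0 : Tendsto β atTop (𝓝 0) := squeeze_zero_norm (fun n => (hβ n).le)
    tendsto_one_div_add_atTop_nhds_zero_nat
  obtain ⟨t₀, ht₀, φ, hφ, hlim⟩ := hS.isCompact.tendsto_subseq (fun n => (ht n).1)
  obtain ⟨g, hg⟩ := exists_increasing_or_nonincreasing_subseq (· < ·) (t ∘ φ)
  have hgm : StrictMono g := g.strictMono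
  -- the contradiction for distinct points along which rd-continuous functions converge
  have key : ∀ ψ : ℕ → ℕ, StrictMono ψ → t₀ ∈ kappa S → Function.Injective (t ∘ ψ) →
      (∀ n, t (ψ n) ≠ t₀) → Tendsto (t ∘ ψ) atTop (𝓝 t₀) →
      (∀ f : ℝ → ℝ, RdContinuousOn S (kappa S) f →
        ∃ m, Tendsto (fun n => f (t (ψ n))) atTop (𝓝 m)) → False :=
    fun ψ hψ hk hinj hne hl hc =>
      hL.not_forall_le_dirDeriv_sub hS hy hη hη1 (t := t ∘ ψ) (fun n => ht _) hk hinj hne hl hc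
        (hα0.comp hψ.tendsto_atTop) (hβ0.comp hψ.tendsto_atTop) he fun n => hcon (ψ n)
  have hl1 : Tendsto (t ∘ (φ ∘ g)) atTop (𝓝 t₀) := hlim.comp hgm.tendsto_atTop
  rcases hg with hg | hg
  · have hsm : StrictMono (t ∘ (φ ∘ g)) := fun m n h => hg m n h
    have hlt : ∀ n, t (φ (g n)) < t₀ := fun n =>
      (hsm (Nat.lt_succ_self n)).trans_le (hsm.monotone.ge_of_tendsto hl1 _)
    have hin : Tendsto (t ∘ (φ ∘ g)) atTop (𝓝[kappa S ∩ Iio t₀] t₀) :=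
      tendsto_nhdsWithin_of_tendsto_nhds_of_eventually_within _ hl1
        (Eventually.of_forall fun n => ⟨ht _, hlt n⟩)
    have hρ : rho S t₀ = t₀ := by
      refine le_antisymm (hS.rho_le ht₀) ?_
      exact le_of_tendsto' hl1 fun n => hS.le_rho (ht _).1 (hlt n)
    refine key _ (hφ.comp hgm) ⟨ht₀, Or.inr hρ⟩ hsm.injective (fun n => (hlt n).ne) hl1
      fun f hf => ?_
    obtain ⟨m, hm⟩ := hf.exists_tendsto_left hS ht₀
    exact ⟨m, hm.comp hin⟩
  obtain ⟨g', hg'⟩ := exists_increasing_or_nonincreasing_subseq (· > ·) (t ∘ φ ∘ g)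
  have hgm' : StrictMono g' := g'.strictMono
  have hl2 : Tendsto (t ∘ (φ ∘ g ∘ g')) atTop (𝓝 t₀) := hl1.comp hgm'.tendsto_atTop
  rcases hg' with hg' | hg'
  · have hsm : StrictAnti (t ∘ (φ ∘ g ∘ g')) := fun m n h => hg' m n h
    have hlt : ∀ n, t₀ < t (φ (g (g' n))) := fun n =>
      lt_of_le_of_lt (hsm.antitone.le_of_tendsto hl2 _) (hsm (Nat.lt_succ_self n))
    have hin : Tendsto (t ∘ (φ ∘ g ∘ g')) atTop (𝓝[kappa S ∩ Ioi t₀] t₀) :=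
      tendsto_nhdsWithin_of_tendsto_nhds_of_eventually_within _ hl2
        (Eventually.of_forall fun n => ⟨ht _, hlt n⟩)
    exact key _ (hφ.comp (hgm.comp hgm'))
      (hS.mem_kappa_of_lt ht₀ ((hlt 0).trans_le (hS.greatest.2 (ht _).1))) hsm.injective
      (fun n => (hlt n).ne') hl2 fun f hf => ⟨_, (hf.tendsto_right hS ht₀).comp hin⟩
  · -- a constant subsequence: continuity of the partial derivatives at one fixed time
    set ψ := φ ∘ g ∘ g'
    have hψm : StrictMono ψ := hφ.comp (hgm.comp hgm')
    have hconst : ∀ n, t (ψ n) = t (ψ 0) := fun n => by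
      rcases Nat.eq_zero_or_pos n with rfl | h
      · rfl
      · exact le_antisymm (not_lt.1 (hg _ _ (hgm' h))) (not_lt.1 (hg' _ _ h))
    set r := t (ψ 0)
    have hrk : r ∈ kappa S := ht _
    obtain ⟨hcu, hcv⟩ := hL.continuous_partials hrk
    have hcont : Continuous fun p : ℝ × ℝ => dirDeriv S L η r p.1 p.2 :=
      (hcu.mul continuous_const).add (hcv.mul continuous_const)
    have hp : Tendsto (fun n => (y (sigma S r) + α (ψ n), deltaDeriv S y r + β (ψ n))) atTop
        (𝓝 (y (sigma S r) + 0, deltaDeriv S y r + 0)) :=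
      ((hα0.comp hψm.tendsto_atTop).const_add _).prodMk_nhds
        ((hβ0.comp hψm.tendsto_atTop).const_add _)
    have h1 := (((hcont.tendsto _).comp hp).sub_const
      (dirDeriv S L η r (y (sigma S r)) (deltaDeriv S y r))).abs
    simp only [add_zero, sub_self, abs_zero] at h1
    obtain ⟨n, hn⟩ := (h1.eventually (gt_mem_nhds he)).exists
    have h2 := hcon (ψ n)
    rw [hconst] at h2
    exact absurd hn (not_lt.2 h2)

/-- The partial derivatives of a regular integrand are continuous at `[y](t)`, uniformly in `t`.
The hypotheses give uniformity only along lines; the directions `η = 1` and `η(t) = t - a + 1`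
separate `L_u` from `L_v`. -/
lemma partials_equicontinuous (hS : IsCompactScale S a b) (hL : IsRegularIntegrand S L)
    {y : ℝ → ℝ} (hy : IsC1rd S y) {e : ℝ} (he : 0 < e) :
    ∃ δ : ℝ, 0 < δ ∧ ∀ t ∈ kappa S, ∀ α β : ℝ, |α| < δ → |β| < δ →
      |partialU L t (y (sigma S t) + α) (deltaDeriv S y t + β) -
        partialU L t (y (sigma S t)) (deltaDeriv S y t)| ≤ e ∧
      |partialV L t (y (sigma S t) + α) (deltaDeriv S y t + β) -
        partialV L t (y (sigma S t)) (deltaDeriv S y t)| ≤ e := by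
  set K := b - a + 1
  have hK1 : 1 ≤ K := by linarith [hS.lt]
  have hd1 : ∀ t ∈ kappa S, deltaDeriv S (fun _ => (1 : ℝ)) t = 0 := fun t ht =>
    (hasDeltaDerivAt_const S 1 t).deltaDeriv_eq hS ht
  have hd2 : ∀ t ∈ kappa S, deltaDeriv S (fun s => s + (1 - a)) t = 1 := fun t ht => by
    have := ((hasDeltaDerivAt_id S t).add (hasDeltaDerivAt_const S (1 - a) t)).deltaDeriv_eq hS ht
    rwa [add_zero] at this
  obtain ⟨δ₁, hδ₁, H₁⟩ := hL.dirDeriv_equicontinuous hS hy (isC1rd_const hS 1) (fun _ _ => le_rfl)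
    (e := e / (2 * K)) (by positivity)
  obtain ⟨δ₂, hδ₂, H₂⟩ := hL.dirDeriv_equicontinuous hS hy
    ((isC1rd_id hS).add hS (isC1rd_const hS (1 - a)))
    (fun t ht => by linarith [hS.least.2 ht]) (e := e / 2) (by positivity)
  refine ⟨min δ₁ δ₂, lt_min hδ₁ hδ₂, fun t ht α β hα hβ => ?_⟩
  have h1 := H₁ t ht α β (hα.trans_le (min_le_left _ _)) (hβ.trans_le (min_le_left _ _))
  have h2 := H₂ t ht α β (hα.trans_le (min_le_right _ _)) (hβ.trans_le (min_le_right _ _))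
  simp only [dirDeriv, hd1 t ht, hd2 t ht, mul_one, mul_zero, add_zero] at h1 h2
  set U := partialU L t (y (sigma S t) + α) (deltaDeriv S y t + β)
  set U' := partialU L t (y (sigma S t)) (deltaDeriv S y t)
  set V := partialV L t (y (sigma S t) + α) (deltaDeriv S y t + β)
  set V' := partialV L t (y (sigma S t)) (deltaDeriv S y t)
  set w := sigma S t + (1 - a)
  have hw1 : |w| ≤ K := by
    have h3 := hS.least.2 (hS.sigma_mem t)
    have h4 := hS.greatest.2 (hS.sigma_mem t)
    rw [abs_of_nonneg] <;> linarith
  have h5 : e / (2 * K) ≤ e := by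
    rw [div_le_iff₀ (by positivity)]
    nlinarith
  refine ⟨h1.le.trans h5, ?_⟩
  have h6 : V - V' = (U * w + V - (U' * w + V')) - (U - U') * w := by ring
  have h7 : |(U - U') * w| ≤ e / 2 := by
    rw [abs_mul]
    calc |U - U'| * |w| ≤ e / (2 * K) * K := by gcongr
      _ = e / 2 := by field_simp
  rw [h6]
  have := abs_sub (U * w + V - (U' * w + V')) ((U - U') * w)
  linarith

end IsRegularIntegrand

/-! ### The first variation -/

/-- The first variation `∫_a^b (L_u[y] η^σ + L_v[y] η^Δ) Δt`, as an integral over the real line. -/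
noncomputable def firstVariation (S : Set ℝ) (a b : ℝ) (L : ℝ → ℝ → ℝ → ℝ) (y η : ℝ → ℝ) : ℝ :=
  ∫ x in a..b, (fun t => along S (partialU L) y t * η (sigma S t) +
    along S (partialV L) y t * deltaDeriv S η t) (lastPoint S x)

/-- The two-parameter variation `y + p₁ η + p₂ ζ`. -/
def perturb (y η ζ : ℝ → ℝ) (p : ℝ × ℝ) (t : ℝ) : ℝ := y t + (p.1 * η t + p.2 * ζ t)

lemma perturb_zero (y η ζ : ℝ → ℝ) : perturb y η ζ 0 = y := by
  ext t; simp [perturb]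

lemma isC1rd_perturb (hS : IsCompactScale S a b) {y η ζ : ℝ → ℝ} (hy : IsC1rd S y)
    (hη : IsC1rd S η) (hζ : IsC1rd S ζ) (p : ℝ × ℝ) : IsC1rd S (perturb y η ζ p) :=
  hy.add hS ((hη.const_mul hS p.1).add hS (hζ.const_mul hS p.2))

lemma deltaDeriv_comb (hS : IsCompactScale S a b) {η ζ : ℝ → ℝ} (hη : IsC1rd S η)
    (hζ : IsC1rd S ζ) (c d : ℝ) {t : ℝ} (ht : t ∈ kappa S) :
    deltaDeriv S (fun s => c * η s + d * ζ s) t = c * deltaDeriv S η t + d * deltaDeriv S ζ t :=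
  (((hη.hasDeltaDerivAt ht).const_mul c).add ((hζ.hasDeltaDerivAt ht).const_mul d)).deltaDeriv_eq
    hS ht

lemma deltaDeriv_perturb (hS : IsCompactScale S a b) {y η ζ : ℝ → ℝ} (hy : IsC1rd S y)
    (hη : IsC1rd S η) (hζ : IsC1rd S ζ) (p : ℝ × ℝ) {t : ℝ} (ht : t ∈ kappa S) :
    deltaDeriv S (perturb y η ζ p) t =
      deltaDeriv S y t + (p.1 * deltaDeriv S η t + p.2 * deltaDeriv S ζ t) :=
  ((hy.hasDeltaDerivAt ht).add (((hη.hasDeltaDerivAt ht).const_mul p.1).add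
    ((hζ.hasDeltaDerivAt ht).const_mul p.2))).deltaDeriv_eq hS ht

lemma functional_eq (hS : IsCompactScale S a b) {L : ℝ → ℝ → ℝ → ℝ}
    (hL : IsRegularIntegrand S L) {y : ℝ → ℝ} (hy : IsC1rd S y) :
    functional S a b L y = ∫ x in a..b, along S L y (lastPoint S x) :=
  deltaIntegral_eq hS (hL.rd y hy) hS.least.1 hS.greatest.1

/-- A function of two variables whose partial derivatives are `e`-close to `A` and `B` near `(u,v)`
is approximated there by `A x + B z`, with error `e` times the `ℓ¹` distance. -/
lemma abs_sub_sub_le_of_partials_near {f fu fv : ℝ → ℝ → ℝ} {u v A B δ e : ℝ}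
    (hu : ∀ x z, HasDerivAt (fun x => f x z) (fu x z) x)
    (hv : ∀ x z, HasDerivAt (fun z => f x z) (fv x z) z)
    (h : ∀ α β : ℝ, |α| < δ → |β| < δ → |fu (u + α) (v + β) - A| ≤ e ∧ |fv (u + α) (v + β) - B| ≤ e)
    {α β α' β' : ℝ} (hα : |α| < δ) (hβ : |β| < δ) (hα' : |α'| < δ) (hβ' : |β'| < δ) :
    |f (u + α) (v + β) - f (u + α') (v + β') - (A * (α - α') + B * (β - β'))| ≤
      e * (|α - α'| + |β - β'|) := by
  have hmem : ∀ c x : ℝ, |x| < δ → c + x ∈ Metric.ball c δ := fun c x hx => by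
    rwa [Metric.mem_ball, Real.dist_eq, add_sub_cancel_left]
  have hmem' : ∀ c x : ℝ, x ∈ Metric.ball c δ → |x - c| < δ := fun c x hx => by
    rwa [Metric.mem_ball, Real.dist_eq] at hx
  have h1 := Convex.norm_image_sub_le_of_norm_hasDerivWithin_le (f := fun x => f x (v + β) - A * x)
    (f' := fun x => fu x (v + β) - A) (s := Metric.ball u δ) (C := e)
    (fun x _ => ((hu x (v + β)).sub (hasDerivAt_const_mul A)).hasDerivWithinAt)
    (fun x hx => by
      have := (h (x - u) β (hmem' _ _ hx) hβ).1
      rwa [add_sub_cancel] at this)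
    (convex_ball u δ) (hmem u α' hα') (hmem u α hα)
  have h2 := Convex.norm_image_sub_le_of_norm_hasDerivWithin_le
    (f := fun z => f (u + α') z - B * z)
    (f' := fun z => fv (u + α') z - B) (s := Metric.ball v δ) (C := e)
    (fun z _ => ((hv (u + α') z).sub (hasDerivAt_const_mul B)).hasDerivWithinAt)
    (fun z hz => by
      have := (h α' (z - v) hα' (hmem' _ _ hz)).2
      rwa [add_sub_cancel] at this)
    (convex_ball v δ) (hmem v β' hβ') (hmem v β hβ)
  simp only [Real.norm_eq_abs, add_sub_add_left_eq_sub] at h1 h2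
  refine le_trans (le_of_eq ?_) ((abs_add_le _ _).trans ((add_le_add h1 h2).trans_eq ?_))
  · congr 1; ring
  · ring

/-- Along a two-parameter family of variations, a functional with regular integrand is strictly
differentiable at the origin, and its partial derivatives are the first variations. -/
lemma hasStrictFDerivAt_functional_perturb (hS : IsCompactScale S a b) {L : ℝ → ℝ → ℝ → ℝ}
    (hL : IsRegularIntegrand S L) {y η ζ : ℝ → ℝ} (hy : IsC1rd S y)
    (hη : IsC1rd S η) (hζ : IsC1rd S ζ) :
    HasStrictFDerivAt (fun p : ℝ × ℝ => functional S a b L (perturb y η ζ p))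
      (firstVariation S a b L y η • ContinuousLinearMap.fst ℝ ℝ ℝ +
        firstVariation S a b L y ζ • ContinuousLinearMap.snd ℝ ℝ ℝ) 0 := by
  obtain ⟨N₁, hN₁, hb₁⟩ := (hη.rdContinuousOn_sigma hS).exists_bound hS
  obtain ⟨N₂, hN₂, hb₂⟩ := (hζ.rdContinuousOn_sigma hS).exists_bound hS
  obtain ⟨N₃, hN₃, hb₃⟩ := hη.2.exists_bound hS
  obtain ⟨N₄, hN₄, hb₄⟩ := hζ.2.exists_bound hS
  set N := N₁ + N₂ + N₃ + N₄
  have hNpos : 0 < N := by positivity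
  have hlin : ∀ (p : ℝ × ℝ) (c d : ℝ), |c| + |d| ≤ N → |p.1 * c + p.2 * d| ≤ N * ‖p‖ := by
    intro p c d hcd
    have h1 : |p.1| ≤ ‖p‖ := norm_fst_le p
    have h2 : |p.2| ≤ ‖p‖ := norm_snd_le p
    calc |p.1 * c + p.2 * d| ≤ |p.1 * c| + |p.2 * d| := abs_add_le _ _
      _ = |p.1| * |c| + |p.2| * |d| := by rw [abs_mul, abs_mul]
      _ ≤ ‖p‖ * |c| + ‖p‖ * |d| := by gcongr
      _ = (|c| + |d|) * ‖p‖ := by ring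
      _ ≤ N * ‖p‖ := by gcongr
  have hba : 0 < b - a := sub_pos.2 hS.lt
  rw [hasStrictFDerivAt_iff_isLittleO, Asymptotics.isLittleO_iff]
  intro e he
  set e' := e / (2 * N * (b - a)) with he'
  obtain ⟨δ, hδ, H⟩ := hL.partials_equicontinuous hS hy (e := e') (by positivity)
  have hball : Metric.ball ((0 : ℝ × ℝ), (0 : ℝ × ℝ)) (δ / N) ∈ 𝓝 ((0 : ℝ × ℝ), (0 : ℝ × ℝ)) :=
    Metric.ball_mem_nhds _ (by positivity)
  filter_upwards [hball] with w hw
  obtain ⟨p, p'⟩ := w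
  rw [Metric.mem_ball, dist_eq_norm, Prod.norm_def, max_lt_iff] at hw
  simp only [Prod.fst_sub, Prod.snd_sub, sub_zero] at hw
  have hp : N * ‖p‖ < δ := by rw [mul_comm]; exact (lt_div_iff₀ hNpos).1 hw.1
  have hp' : N * ‖p'‖ < δ := by rw [mul_comm]; exact (lt_div_iff₀ hNpos).1 hw.2
  set D : (ℝ → ℝ) → ℝ → ℝ := fun η t => along S (partialU L) y t * η (sigma S t) +
    along S (partialV L) y t * deltaDeriv S η t with hD
  have hDη : RdContinuousOn S (kappa S) (D η) := hL.rd_dirDeriv hS hy hη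
  have hDζ : RdContinuousOn S (kappa S) (D ζ) := hL.rd_dirDeriv hS hy hζ
  have hLp := hL.rd _ (isC1rd_perturb hS hy hη hζ p)
  have hLp' := hL.rd _ (isC1rd_perturb hS hy hη hζ p')
  have haS := hS.least.1
  have hbS := hS.greatest.1
  have hI : functional S a b L (perturb y η ζ p) - functional S a b L (perturb y η ζ p') -
      ((p.1 - p'.1) * firstVariation S a b L y η + (p.2 - p'.2) * firstVariation S a b L y ζ) =
      ∫ x in a..b, (fun t => along S L (perturb y η ζ p) t - along S L (perturb y η ζ p') t -
        ((p.1 - p'.1) * D η t + (p.2 - p'.2) * D ζ t)) (lastPoint S x) := by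
    have i1 := hLp.intervalIntegrable hS haS hbS
    have i2 := hLp'.intervalIntegrable hS haS hbS
    have i3 := (hDη.intervalIntegrable hS haS hbS).const_mul (p.1 - p'.1)
    have i4 := (hDζ.intervalIntegrable hS haS hbS).const_mul (p.2 - p'.2)
    rw [intervalIntegral.integral_sub (i1.sub i2) (i3.add i4), intervalIntegral.integral_sub i1 i2,
      intervalIntegral.integral_add i3 i4, intervalIntegral.integral_const_mul,
      intervalIntegral.integral_const_mul, functional_eq hS hL (isC1rd_perturb hS hy hη hζ p),
      functional_eq hS hL (isC1rd_perturb hS hy hη hζ p')]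
    rfl
  have hbound := abs_integral_lastPoint_sub_le hS (m := 0) (ε := e' * (2 * N * ‖p - p'‖))
    ((hLp.sub hLp').sub ((hDη.const_mul (p.1 - p'.1)).add (hDζ.const_mul (p.2 - p'.2))))
    haS hbS hS.lt.le (fun t ht _ _ => by
      have c1 : |η (sigma S t)| + |ζ (sigma S t)| ≤ N := by
        linarith [hb₁ t ht, hb₂ t ht]
      have c2 : |deltaDeriv S η t| + |deltaDeriv S ζ t| ≤ N := by
        linarith [hb₃ t ht, hb₄ t ht]
      have key := abs_sub_sub_le_of_partials_near (f := L t) (hL.hasDerivAt_u ht)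
        (fun x z => hL.hasDerivAt_v ht x z) (H t ht)
        ((hlin p _ _ c1).trans_lt hp) ((hlin p _ _ c2).trans_lt hp)
        ((hlin p' _ _ c1).trans_lt hp') ((hlin p' _ _ c2).trans_lt hp')
      have d1 := hlin (p - p') _ _ c1
      have d2 := hlin (p - p') _ _ c2
      have e1 : p.1 * η (sigma S t) + p.2 * ζ (sigma S t) -
          (p'.1 * η (sigma S t) + p'.2 * ζ (sigma S t)) =
          (p - p').1 * η (sigma S t) + (p - p').2 * ζ (sigma S t) := by
        simp only [Prod.fst_sub, Prod.snd_sub]; ring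
      have e2 : p.1 * deltaDeriv S η t + p.2 * deltaDeriv S ζ t -
          (p'.1 * deltaDeriv S η t + p'.2 * deltaDeriv S ζ t) =
          (p - p').1 * deltaDeriv S η t + (p - p').2 * deltaDeriv S ζ t := by
        simp only [Prod.fst_sub, Prod.snd_sub]; ring
      rw [e1, e2] at key
      simp only [along, deltaDeriv_perturb hS hy hη hζ _ ht, perturb, hD, sub_zero]
      refine le_trans (le_of_eq ?_) (key.trans ?_)
      · congr 1
        simp only [Prod.fst_sub, Prod.snd_sub]
        ring
      · have : 0 < e' := by positivity
        refine mul_le_mul_of_nonneg_left ?_ this.le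
        linarith)
  rw [zero_mul, sub_zero, ← hI] at hbound
  simp only [add_apply, smul_apply,
    ContinuousLinearMap.coe_fst', ContinuousLinearMap.coe_snd', smul_eq_mul, Prod.fst_sub,
    Prod.snd_sub, Real.norm_eq_abs]
  rw [mul_comm (firstVariation S a b L y η), mul_comm (firstVariation S a b L y ζ)]
  refine hbound.trans (le_of_eq ?_)
  rw [he']
  field_simp

/-! ### The lemma of du Bois-Reymond -/

lemma HasDeltaDerivAt.congr (hS : IsCompactScale S a b) {f g : ℝ → ℝ} {m t : ℝ}
    (h : EqOn f g S) (hf : HasDeltaDerivAt S f m t) : HasDeltaDerivAt S g m t := fun ε hε => by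
  obtain ⟨δ, hδ, H⟩ := hf ε hε
  refine ⟨δ, hδ, fun s hs hd => ?_⟩
  rw [← h (hS.sigma_mem t), ← h hs]
  exact H s hs hd

/-- A nonnegative rd-continuous function with zero integral vanishes: its integral function is zero,
so its `Δ`-derivative is zero. -/
lemma eq_zero_of_integral_eq_zero (hS : IsCompactScale S a b) {f : ℝ → ℝ}
    (hf : RdContinuousOn S (kappa S) f) (h0 : ∀ t, 0 ≤ f t)
    (hI : ∫ x in a..b, f (lastPoint S x) = 0) {t : ℝ} (ht : t ∈ kappa S) : f t = 0 := by
  have hE : EqOn (fun s => ∫ x in a..s, f (lastPoint S x)) (fun _ => 0) S := by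
    intro s hs
    have h1 := intervalIntegral.integral_add_adjacent_intervals
      (hf.intervalIntegrable hS hS.least.1 hs) (hf.intervalIntegrable hS hs hS.greatest.1)
    have h2 : 0 ≤ ∫ x in a..s, f (lastPoint S x) :=
      intervalIntegral.integral_nonneg (hS.least.2 hs) fun _ _ => h0 _
    have h3 : 0 ≤ ∫ x in s..b, f (lastPoint S x) :=
      intervalIntegral.integral_nonneg (hS.greatest.2 hs) fun _ _ => h0 _
    simp only
    linarith
  exact ((hasDeltaDerivAt_integral hS hf hS.least.1 ht).congr hS hE).unique hS ht
    (hasDeltaDerivAt_const S 0 t)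

/-- The lemma of du Bois-Reymond on a time scale. With `P` the integral of `p` and `c` the mean of
`r - P`, it is tested with the integral of `r - P - c`. -/
lemma exists_const_of_integral_eq_zero (hS : IsCompactScale S a b) {p r : ℝ → ℝ}
    (hp : RdContinuousOn S (kappa S) p) (hr : RdContinuousOn S (kappa S) r)
    (h : ∀ η : ℝ → ℝ, IsC1rd S η → η a = 0 → η b = 0 →
      ∫ x in a..b, (fun t => p t * η (sigma S t) + r t * deltaDeriv S η t) (lastPoint S x) = 0) :
    ∃ c : ℝ, ∀ t ∈ kappa S, r t - ∫ x in a..t, p (lastPoint S x) = c := by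
  have haS := hS.least.1
  have hbS := hS.greatest.1
  set P : ℝ → ℝ := fun s => ∫ x in a..s, p (lastPoint S x)
  have hPC : IsC1rd S P := isC1rd_integral hS hp haS
  have hPd : ∀ t ∈ kappa S, HasDeltaDerivAt S P (p t) t := fun t ht =>
    hasDeltaDerivAt_integral hS hp haS ht
  have hw : RdContinuousOn S (kappa S) (fun t => r t - P t) := hr.sub hPC.rdContinuousOn
  set c := (∫ x in a..b, (fun t => r t - P t) (lastPoint S x)) / (b - a) with hc
  have hwc : RdContinuousOn S (kappa S) (fun t => r t - P t - c) :=
    hw.sub continuous_const.rdContinuousOn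
  set η : ℝ → ℝ := fun s => ∫ x in a..s, (fun t => r t - P t - c) (lastPoint S x)
  have hηC : IsC1rd S η := isC1rd_integral hS hwc haS
  have hηd : ∀ t ∈ kappa S, deltaDeriv S η t = r t - P t - c := fun t ht =>
    (hasDeltaDerivAt_integral hS hwc haS ht).deltaDeriv_eq hS ht
  have hηa : η a = 0 := intervalIntegral.integral_same
  have hηb : η b = 0 := by
    show ∫ x in a..b, ((fun t => r t - P t) (lastPoint S x) - c) = 0
    have hba : b - a ≠ 0 := (sub_pos.2 hS.lt).ne'
    rw [intervalIntegral.integral_sub (hw.intervalIntegrable hS haS hbS) intervalIntegrable_const,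
      intervalIntegral.integral_const, smul_eq_mul, hc, mul_div_cancel₀ _ hba, sub_self]
  have hrd₁ : RdContinuousOn S (kappa S) (fun t => p t * η (sigma S t) + r t * deltaDeriv S η t) :=
    (hp.mul (hηC.rdContinuousOn_sigma hS)).add (hr.mul hηC.2)
  have hrd₂ : RdContinuousOn S (kappa S) (fun t => p t * η (sigma S t) + P t * deltaDeriv S η t) :=
    (hp.mul (hηC.rdContinuousOn_sigma hS)).add (hPC.rdContinuousOn.mul hηC.2)
  have hI₁ := h η hηC hηa hηb
  have hI₂ : ∫ x in a..b, (fun t => p t * η (sigma S t) + P t * deltaDeriv S η t)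
      (lastPoint S x) = 0 := by
    rw [integral_lastPoint_eq_sub hS (F := fun t => P t * η t) hrd₂
      (fun t ht => (hPd t ht).mul ht.1 (hηC.hasDeltaDerivAt ht)) haS hbS, hηa, hηb]
    simp
  have hI₃ : ∫ x in a..b, (fun t => c * (r t - P t - c)) (lastPoint S x) = 0 := by
    simp only [intervalIntegral.integral_const_mul]
    exact mul_eq_zero_of_right c hηb
  have hsq : ∫ x in a..b, (fun t => (r t - P t - c) ^ 2) (lastPoint S x) = 0 := by
    have e1 := integral_lastPoint_congr hS (f := fun t => (r t - P t - c) ^ 2)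
      (g := fun t => (p t * η (sigma S t) + r t * deltaDeriv S η t) -
        (p t * η (sigma S t) + P t * deltaDeriv S η t) - c * (r t - P t - c))
      (fun t ht => by simp only [hηd t ht]; ring) haS hbS hS.lt.le
    rw [e1]
    have i1 := hrd₁.intervalIntegrable hS haS hbS
    have i2 := hrd₂.intervalIntegrable hS haS hbS
    have i3 := (hwc.const_mul c).intervalIntegrable hS haS hbS
    rw [intervalIntegral.integral_sub (i1.sub i2) i3, intervalIntegral.integral_sub i1 i2]
    simp only at hI₁ hI₂ hI₃
    rw [hI₁, hI₂, hI₃]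
    simp
  refine ⟨c, fun t ht => ?_⟩
  have hrd : RdContinuousOn S (kappa S) (fun t => (r t - P t - c) ^ 2) :=
    (hwc.mul hwc).congr fun t _ => (sq _).symm
  have := eq_zero_of_integral_eq_zero hS hrd (fun t => sq_nonneg _) hsq ht
  have := pow_eq_zero_iff (two_ne_zero) |>.1 this
  linarith

/-! ### From the integrated to the differential Euler–Lagrange equation -/

lemma IsCompactScale.sigma_kappa (hS : IsCompactScale S a b) {t : ℝ} (ht : t ∈ kappa S)
    (hσ : sigma S t ∈ kappa S) : sigma (kappa S) t = sigma S t := by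
  rcases (hS.le_sigma ht.1).lt_or_eq with h | h
  · have hl : IsLeast {s | s ∈ kappa S ∧ t < s} (sigma S t) :=
      ⟨⟨hσ, h⟩, fun s hs => hS.sigma_le hs.1.1 hs.2⟩
    rw [sigma, if_pos hl.nonempty, hl.csInf_eq]
  rcases (hS.greatest.2 ht.1).lt_or_eq with htb | htb
  · have hex : ∀ c, t < c → ∃ s, (s ∈ kappa S ∧ t < s) ∧ s < c := fun c hc => by
      obtain ⟨s, hs, h1, h2⟩ := hS.exists_mem_Ioo_of_sigma_eq htb h.symm (lt_min hc htb)
      exact ⟨s, ⟨hS.mem_kappa_of_lt hs (h2.trans_le (min_le_right _ _)), h1⟩,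
        h2.trans_le (min_le_left _ _)⟩
    have hne : {s | s ∈ kappa S ∧ t < s}.Nonempty := by
      obtain ⟨s, hs, -⟩ := hex b htb
      exact ⟨s, hs⟩
    rw [sigma, if_pos hne, ← h]
    refine csInf_eq_of_forall_ge_of_forall_gt_exists_lt hne (fun s hs => hs.2.le) ?_
    intro c hc
    obtain ⟨s, hs, hsc⟩ := hex c hc
    exact ⟨s, hs, hsc⟩
  · have hne : ¬ {s | s ∈ kappa S ∧ t < s}.Nonempty := by
      rintro ⟨s, hs, hts⟩
      exact absurd (hS.greatest.2 hs.1) (not_le.2 (htb ▸ hts))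
    have hg : IsGreatest (kappa S) t := ⟨ht, fun s hs => htb ▸ hS.greatest.2 hs.1⟩
    rw [sigma, if_neg hne, hg.csSup_eq, ← h]

/-- If `r - ∫_a^t p` is constant on `S^κ`, then `r` has on the time scale `S^κ` the `Δ`-derivative
`p`, with the left-hand limit of `p` at a point before a left-scattered maximum of `S`. -/
lemma hasDeltaDerivAt_kappa_of_sub_integral_eq (hS : IsCompactScale S a b) {p r : ℝ → ℝ} {c : ℝ}
    (hp : RdContinuousOn S (kappa S) p)
    (h : ∀ t ∈ kappa S, r t - ∫ x in a..t, p (lastPoint S x) = c) :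
    (∀ t ∈ kappa (kappa S), sigma S t ∈ kappa S → HasDeltaDerivAt (kappa S) r (p t) t) ∧
    (∀ t ∈ kappa (kappa S), sigma S t ∉ kappa S →
      ∃ m : ℝ, Tendsto p (𝓝[kappa S ∩ Iio t] t) (𝓝 m) ∧ HasDeltaDerivAt (kappa S) r m t) := by
  have haS := hS.least.1
  refine ⟨fun t ht hσ ε hε => ?_, fun t ht hσ => ?_⟩
  · obtain ⟨δ, hδ, H⟩ := hasDeltaDerivAt_integral hS hp haS ht.1 ε hε
    refine ⟨δ, hδ, fun s hs hd => ?_⟩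
    have h1 := H s hs.1 hd
    rw [hS.sigma_kappa ht.1 hσ]
    have e1 := h _ hσ
    have e2 := h s hs
    have e3 : r (sigma S t) - r s = (∫ x in a..sigma S t, p (lastPoint S x)) -
      ∫ x in a..s, p (lastPoint S x) := by linarith
    rwa [e3]
  · have htk := ht.1
    have hσb : sigma S t = b := by
      by_contra hne
      exact hσ (hS.mem_kappa_of_lt (hS.sigma_mem t)
        (lt_of_le_of_ne (hS.greatest.2 (hS.sigma_mem t)) hne))
    have hmax : ∀ s ∈ kappa S, s ≤ t := fun s hs => by
      by_contra! hts
      have h1 := hS.sigma_le hs.1 hts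
      rw [hσb] at h1
      exact hσ (hσb ▸ le_antisymm (hS.greatest.2 hs.1) h1 ▸ hs)
    have hσt : sigma (kappa S) t = t := by
      have hne : ¬ {s | s ∈ kappa S ∧ t < s}.Nonempty := by
        rintro ⟨s, hs, hts⟩
        exact absurd (hmax s hs) (not_le.2 hts)
      have hg : IsGreatest (kappa S) t := ⟨htk, hmax⟩
      rw [sigma, if_neg hne, hg.csSup_eq]
    obtain ⟨m, hm⟩ := hp.exists_tendsto_left hS htk.1
    refine ⟨m, hm, fun ε hε => ?_⟩
    obtain ⟨δ, hδ, H⟩ := Metric.tendsto_nhdsWithin_nhds.1 hm ε hε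
    refine ⟨δ, hδ, fun s hs hd => ?_⟩
    have hst := hmax s hs
    rw [hσt, abs_of_nonneg (sub_nonneg.2 hst)]
    have e1 := h t htk
    have e2 := h s hs
    have e3 := intervalIntegral.integral_interval_sub_left
      (hp.intervalIntegrable hS haS htk.1) (hp.intervalIntegrable hS haS hs.1)
    have e4 : r t - r s = ∫ x in s..t, p (lastPoint S x) := by linarith
    rw [e4]
    refine abs_integral_lastPoint_sub_le hS hp hs.1 htk.1 hst fun q hq h1 h2 => ?_
    refine (H ⟨hq, h2⟩ ?_).le
    rw [abs_lt] at hd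
    rw [Real.dist_eq, abs_lt]
    constructor <;> linarith

/-! ### The multiplier rule -/

lemma c1norm_le (hS : IsCompactScale S a b) {f : ℝ → ℝ} {M N : ℝ}
    (h1 : ∀ t ∈ kappa S, |f (sigma S t)| ≤ M) (h2 : ∀ t ∈ kappa S, |deltaDeriv S f t| ≤ N) :
    c1norm S f ≤ M + N := by
  have hne : (kappa S).Nonempty := ⟨a, hS.min_mem_kappa⟩
  refine add_le_add (csSup_le (hne.image _) ?_) (csSup_le (hne.image _) ?_)
  · rintro _ ⟨t, ht, rfl⟩; exact h1 t ht
  · rintro _ ⟨t, ht, rfl⟩; exact h2 t ht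

lemma tendsto_c1norm_comb (hS : IsCompactScale S a b) {η ζ : ℝ → ℝ} (hη : IsC1rd S η)
    (hζ : IsC1rd S ζ) {δ : ℝ} (hδ : 0 < δ) :
    ∀ᶠ p : ℝ × ℝ in 𝓝 0, c1norm S (fun t => p.1 * η t + p.2 * ζ t) < δ := by
  obtain ⟨N₁, -, hb₁⟩ := (hη.rdContinuousOn_sigma hS).exists_bound hS
  obtain ⟨N₂, -, hb₂⟩ := (hζ.rdContinuousOn_sigma hS).exists_bound hS
  obtain ⟨N₃, -, hb₃⟩ := hη.2.exists_bound hS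
  obtain ⟨N₄, -, hb₄⟩ := hζ.2.exists_bound hS
  have hcont : Continuous fun p : ℝ × ℝ =>
      (|p.1| * N₁ + |p.2| * N₂) + (|p.1| * N₃ + |p.2| * N₄) := by fun_prop
  have h0 := hcont.tendsto 0
  simp only [Prod.fst_zero, Prod.snd_zero, abs_zero, zero_mul, add_zero] at h0
  filter_upwards [h0.eventually (gt_mem_nhds hδ)] with p hp
  have hlin : ∀ {c d C D : ℝ}, |c| ≤ C → |d| ≤ D → |p.1 * c + p.2 * d| ≤ |p.1| * C + |p.2| * D := by
    intro c d C D hc hd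
    refine (abs_add_le _ _).trans ?_
    rw [abs_mul, abs_mul]
    gcongr
  refine (c1norm_le hS (fun t ht => hlin (hb₁ t ht) (hb₂ t ht)) fun t ht => ?_).trans_lt hp
  rw [deltaDeriv_comb hS hη hζ _ _ ht]
  exact hlin (hb₃ t ht) (hb₄ t ht)

/-- At a local minimiser, the gradients of the functional and of the constraint along any
two-parameter family of variations with fixed endpoints are linearly dependent. -/
lemma IsLocalMinimiser.exists_multipliers (hS : IsCompactScale S a b) {L g : ℝ → ℝ → ℝ → ℝ}
    (hL : IsRegularIntegrand S L) (hg : IsRegularIntegrand S g) {ya yb l : ℝ} {y : ℝ → ℝ}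
    (hmin : IsLocalMinimiser S a b L g ya yb l y) {η ζ : ℝ → ℝ} (hη : IsC1rd S η)
    (hηa : η a = 0) (hηb : η b = 0) (hζ : IsC1rd S ζ) (hζa : ζ a = 0) (hζb : ζ b = 0) :
    ∃ c d : ℝ, (c, d) ≠ 0 ∧
      c * firstVariation S a b g y η + d * firstVariation S a b L y η = 0 ∧
      c * firstVariation S a b g y ζ + d * firstVariation S a b L y ζ = 0 := by
  obtain ⟨⟨hy, hya, hyb, hyl⟩, δ, hδ, hm⟩ := hmin
  have hextr : IsLocalExtrOn (fun p : ℝ × ℝ => functional S a b L (perturb y η ζ p))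
      {p | functional S a b g (perturb y η ζ p) = functional S a b g (perturb y η ζ 0)} 0 := by
    refine Or.inl ?_
    filter_upwards [self_mem_nhdsWithin,
      nhdsWithin_le_nhds (tendsto_c1norm_comb hS hη hζ hδ)] with p hp hpn
    rw [perturb_zero]
    refine hm _ ⟨isC1rd_perturb hS hy hη hζ p, ?_, ?_, ?_⟩ ?_
    · simp [perturb, hηa, hζa, hya]
    · simp [perturb, hηb, hζb, hyb]
    · rw [← hyl]
      have hp' : functional S a b g (perturb y η ζ p) =
        functional S a b g (perturb y η ζ 0) := hp
      rw [hp', perturb_zero]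
    · simpa only [perturb, add_sub_cancel_left] using hpn
  obtain ⟨c, d, hne, h⟩ := hextr.exists_multipliers_of_hasStrictFDerivAt_1d
    (hasStrictFDerivAt_functional_perturb hS hg hy hη hζ)
    (hasStrictFDerivAt_functional_perturb hS hL hy hη hζ)
  refine ⟨c, d, hne, ?_, ?_⟩
  · simpa using DFunLike.congr_fun h ((1 : ℝ), (0 : ℝ))
  · simpa using DFunLike.congr_fun h ((0 : ℝ), (1 : ℝ))

end

end TimeScale

open TimeScale in
theorem theoremT1 (T : Set ℝ) (hT : IsClosed T) (a b : ℝ) (ha : a ∈ T) (hb : b ∈ T) (hab : a < b)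
    (L g : ℝ → ℝ → ℝ → ℝ)
    (hL : TimeScale.IsRegularIntegrand (TimeScale.interval T a b) L)
    (hg : TimeScale.IsRegularIntegrand (TimeScale.interval T a b) g)
    (ya yb l : ℝ) (ystar : ℝ → ℝ)
    (hmin : TimeScale.IsLocalMinimiser (TimeScale.interval T a b) a b L g ya yb l ystar)
    (hext : ¬ TimeScale.IsExtremal (TimeScale.interval T a b) a g ystar) :
    ∃ lam : ℝ, TimeScale.SatisfiesEulerLagrange (TimeScale.interval T a b)
      (fun t u v => L t u v - lam * g t u v) ystar := by
  have hS := isCompactScale_interval hT ha hb hab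
  set S := interval T a b
  have hy : IsC1rd S ystar := hmin.1.1
  -- a direction in which the first variation of the constraint does not vanish
  obtain ⟨η, hη, hηa, hηb, hη0⟩ : ∃ η, IsC1rd S η ∧ η a = 0 ∧ η b = 0 ∧
      firstVariation S a b g ystar η ≠ 0 := by
    by_contra! hcon
    obtain ⟨c, hc⟩ := exists_const_of_integral_eq_zero hS (hg.rd_u _ hy) (hg.rd_v _ hy) hcon
    refine hext ⟨c, fun t ht => ?_⟩
    rw [deltaIntegral_eq hS (hg.rd_u _ hy) hS.least.1 ht.1]
    exact hc t ht
  set lam := firstVariation S a b L ystar η / firstVariation S a b g ystar η with hlam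
  have hvar : ∀ ζ, IsC1rd S ζ → ζ a = 0 → ζ b = 0 →
      firstVariation S a b L ystar ζ = lam * firstVariation S a b g ystar ζ := by
    intro ζ hζ hζa hζb
    obtain ⟨c, d, hne, h1, h2⟩ := hmin.exists_multipliers hS hL hg hη hηa hηb hζ hζa hζb
    have hd : d ≠ 0 := by
      rintro rfl
      rw [zero_mul, add_zero] at h1
      exact hne (by rw [(mul_eq_zero.1 h1).resolve_right hη0]; rfl)
    refine mul_left_cancel₀ hd ?_
    have h3 : d * lam = -c := by
      rw [hlam, ← mul_div_assoc, div_eq_iff hη0]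
      linarith
    rw [← mul_assoc, h3]
    linarith
  refine ⟨lam, ?_⟩
  set F : ℝ → ℝ → ℝ → ℝ := fun t u v => L t u v - lam * g t u v
  have hFu : EqOn (fun t => along S (partialU L) ystar t - lam * along S (partialU g) ystar t)
      (along S (partialU F) ystar) (kappa S) := fun t ht =>
    ((hL.hasDerivAt_u ht _ _).sub ((hg.hasDerivAt_u ht _ _).const_mul lam)).deriv.symm
  have hFv : EqOn (fun t => along S (partialV L) ystar t - lam * along S (partialV g) ystar t)
      (along S (partialV F) ystar) (kappa S) := fun t ht =>
    ((hL.hasDerivAt_v ht _ _).sub ((hg.hasDerivAt_v ht _ _).const_mul lam)).deriv.symm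
  have hrdu : RdContinuousOn S (kappa S) (along S (partialU F) ystar) :=
    ((hL.rd_u _ hy).sub ((hg.rd_u _ hy).const_mul lam)).congr hFu
  have hrdv : RdContinuousOn S (kappa S) (along S (partialV F) ystar) :=
    ((hL.rd_v _ hy).sub ((hg.rd_v _ hy).const_mul lam)).congr hFv
  obtain ⟨c, hc⟩ := exists_const_of_integral_eq_zero hS hrdu hrdv fun ζ hζ hζa hζb => by
    have i1 := (hL.rd_dirDeriv hS hy hζ).intervalIntegrable hS hS.least.1 hS.greatest.1
    have i2 := ((hg.rd_dirDeriv hS hy hζ).const_mul lam).intervalIntegrable hS hS.least.1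
      hS.greatest.1
    have e : ∫ x in a..b, (fun t => along S (partialU F) ystar t * ζ (sigma S t) +
        along S (partialV F) ystar t * deltaDeriv S ζ t) (lastPoint S x) =
        firstVariation S a b L ystar ζ - lam * firstVariation S a b g ystar ζ := by
      have e1 := integral_lastPoint_congr hS
        (f := fun t => along S (partialU F) ystar t * ζ (sigma S t) +
          along S (partialV F) ystar t * deltaDeriv S ζ t)
        (g := fun t => dirDeriv S L ζ t (ystar (sigma S t)) (deltaDeriv S ystar t) -
          lam * dirDeriv S g ζ t (ystar (sigma S t)) (deltaDeriv S ystar t))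
        (fun t ht => by
          have h1 := hFu ht
          have h2 := hFv ht
          simp only [along] at h1 h2
          simp only [dirDeriv, along]
          rw [← h1, ← h2]
          ring)
        hS.least.1 hS.greatest.1 hS.lt.le
      rw [e1, intervalIntegral.integral_sub i1 i2, intervalIntegral.integral_const_mul]
      rfl
    rw [e, hvar ζ hζ hζa hζb, sub_self]
  exact hasDeltaDerivAt_kappa_of_sub_integral_eq hS hrdu hc
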